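/- **Theorem (Optimistic FD score).** Let $f$ map samples to feature vectors in $\mathbb{R}^d$, and let $p_g$ be a generator whose embedding $f(X_g)$, $X_g\sim p_g$, has the multivariate Gaussian law $\mathcal{N}(\mu_g,\Sigma_g)$. Let $\mu_{\mathrm r}\in\mathbb{R}^d$ and $\Sigma_{\mathrm r}$ be the mean and the covariance matrix of the real-data embeddings, with $\Sigma_{\mathrm r}$ positive definite. Write $\|\cdot\|_2$ for the Euclidean norm of vectors and the spectral norm of matrices, and let $$\mathrm{FD}_g=\|\mu_g-\mu_{\mathrm r}\|_2^2+\mathrm{Tr}\big[\Sigma_g+\Sigma_{\mathrm r}-2(\Sigma_g\Sigma_{\mathrm r})^{1/2}\big],$$ where $A^{1/2}$ denotes the principal square root (the diagonalizable one with nonnegative eigenvalues). For independent samples $x^1,\dots,x^n\sim p_g$ put $$\widehat\mu_g^n=\frac1n\sum_{i=1}^n f(x^i),\qquad \widehat\Sigma_g^n=\frac1n\sum_{i=1}^n\big(f(x^i)-\widehat\mu_g^n\big)\big(f(x^i)-\widehat\mu_g^n\big)^\top,$$ $$\widetilde{\mathrm{FD}}{}_g^n=\|\widehat\mu_g^n-\mu_{\mathrm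 r}\|_2^2+\mathrm{Tr}\big[\widehat\Sigma_g^n+\Sigma_{\mathrm r}-2(\widehat\Sigma_g^n\Sigma_{\mathrm r})^{1/2}\big].$$ Let $\mathbf r(\Sigma_g)=\mathrm{Tr}[\Sigma_g]/\|\Sigma_g\|_2$ be the effective rank (with $\mathbf r(0):=0$), and let $\kappa$ be a constant such that $\|y^\top(f(X_g)-\mu_g)\|_{\psi_2}\le\kappa\sqrt{y^\top\Sigma_g y}$ for all $y\in\mathbb{R}^d$, where $\|Z\|_{\psi_2}=\inf\{t>0:\mathbb{E}[\exp(Z^2/t^2)]\le 2\}$. For $\delta\in(0,1)$ set $$\Delta_{\mu_g}^n=\sqrt{\frac1n\Big(\sqrt{8\,\mathrm{Tr}[\Sigma_g^2]\log(6/\delta)}+8\|\Sigma_g\|_2\log(6/\delta)\Big)},$$ $$\Delta_{\Sigma_g}^n=20\kappa^2\|\Sigma_g\|_2\sqrt{\frac{4\mathbf r(\Sigma_g)+\log(3/\delta)}{n}}+(\Delta_{\mu_g}^n)^2,$$ $$\mathcal{B}_g^n=2\Delta_{\mu_g}^n\big(\Delta_{\mu_g}^n+\|\widehat\mu_g^n-\mu_{\mathrm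 r}\|_2\big)+\mathrm{Tr}\big[\Sigma_{\mathrm r}^{1/2}\big]\sqrt{8\Delta_{\Sigma_g}^n}+\mathrm{Tr}[\Sigma_g]\sqrt{\frac8n\log\frac6\delta}+\frac{8\|\Sigma_g\|_2}{n}\log\frac6\delta.$$ Then for every $n\ge 4\mathbf r(\Sigma_g)+\log(3/\delta)$, with probability at least $1-\delta$, $$\widetilde{\mathrm{FD}}{}_g^n-\mathcal{B}_g^n\le\mathrm{FD}_g .$$ -/

import Mathlib

open MeasureTheory ProbabilityTheory
open scoped MatrixOrder Matrix

namespace FrechetOnline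

/-- `R` is the principal square root of the square matrix `A`: it squares to `A` and it is
diagonalizable over `ℝ` with nonnegative eigenvalues. -/
def IsPrincipalSqrt {d : ℕ} (A R : Matrix (Fin d) (Fin d) ℝ) : Prop :=
  R * R = A ∧ ∃ (Q : Matrix (Fin d) (Fin d) ℝ) (v : Fin d → ℝ),
    IsUnit Q ∧ (∀ i, 0 ≤ v i) ∧ R * Q = Q * Matrix.diagonal v

/-- There is at most one principal square root. -/
theorem IsPrincipalSqrt.unique {d : ℕ} {A R R' : Matrix (Fin d) (Fin d) ℝ}
    (h : IsPrincipalSqrt A R) (h' : IsPrincipalSqrt A R') : R = R' := by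
  obtain ⟨hR, Q, v, hQ, hv, hRQ⟩ := h
  obtain ⟨hR', Q', v', hQ', hv', hRQ'⟩ := h'
  obtain ⟨U, hU1, hU2⟩ : ∃ U, U * Q = 1 ∧ Q * U = 1 := by
    obtain ⟨u, rfl⟩ := hQ
    exact ⟨(u⁻¹ : (Matrix (Fin d) (Fin d) ℝ)ˣ), u.inv_mul, u.mul_inv⟩
  have hUR : U * R = Matrix.diagonal v * U := by
    calc U * R = U * (R * Q) * U := by rw [Matrix.mul_assoc, Matrix.mul_assoc, hU2, Matrix.mul_one]
      _ = Matrix.diagonal v * U := by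
        rw [hRQ, ← Matrix.mul_assoc, hU1, Matrix.one_mul]
  have h2 : Matrix.diagonal v * (Matrix.diagonal v * (U * Q')) =
      U * Q' * Matrix.diagonal v' * Matrix.diagonal v' := by
    calc Matrix.diagonal v * (Matrix.diagonal v * (U * Q'))
        = U * (R * R) * Q' := by
          rw [← Matrix.mul_assoc (Matrix.diagonal v) U, ← hUR, ← Matrix.mul_assoc,
            ← Matrix.mul_assoc (Matrix.diagonal v) U, ← hUR]
          simp only [Matrix.mul_assoc]
      _ = U * (R' * (R' * Q')) := by rw [hR, ← hR']; simp only [Matrix.mul_assoc]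
      _ = U * Q' * Matrix.diagonal v' * Matrix.diagonal v' := by
          rw [hRQ', ← Matrix.mul_assoc R', hRQ']; simp only [Matrix.mul_assoc]
  have h3 : Matrix.diagonal v * (U * Q') = U * Q' * Matrix.diagonal v' := by
    ext i j
    have := congrFun (congrFun h2 i) j
    simp only [Matrix.diagonal_mul, Matrix.mul_diagonal] at this ⊢
    by_cases hz : (U * Q') i j = 0
    · simp [hz]
    · have h4 : v i * v i = v' j * v' j := by
        apply mul_right_cancel₀ hz
        linarith
      rw [(mul_self_inj (hv i) (hv' j)).1 h4, mul_comm]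
  have h5 : R * Q' = R' * Q' := by
    calc R * Q' = Q * (U * R) * Q' := by rw [← Matrix.mul_assoc, hU2, Matrix.one_mul]
      _ = Q * (Matrix.diagonal v * (U * Q')) := by rw [hUR]; simp only [Matrix.mul_assoc]
      _ = R' * Q' := by rw [h3, hRQ', Matrix.mul_assoc U, ← Matrix.mul_assoc Q, hU2, Matrix.one_mul]
  exact hQ'.mul_right_cancel h5

/-- For `S` positive semidefinite and `T` positive definite, the product `S * T` has a principal
square root, namely `T^{-1/2} (T^{1/2} S T^{1/2})^{1/2} T^{1/2}`. -/
theorem isPrincipalSqrt_mul {d : ℕ} {S T : Matrix (Fin d) (Fin d) ℝ}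
    (hS : S.PosSemidef) (hT : T.PosDef) :
    IsPrincipalSqrt (S * T)
      ((CFC.sqrt T)⁻¹ * CFC.sqrt (CFC.sqrt T * S * CFC.sqrt T) * CFC.sqrt T) := by
  set B := CFC.sqrt T with hB
  have hBB : B * B = T := CFC.sqrt_mul_sqrt_self T hT.posSemidef.nonneg
  have hBpos : B.PosSemidef := Matrix.nonneg_iff_posSemidef.1 (CFC.sqrt_nonneg T)
  have hBu : IsUnit B := isUnit_of_mul_isUnit_left (hBB ▸ hT.isUnit)
  have hBdet : IsUnit B.det := (Matrix.isUnit_iff_isUnit_det B).1 hBu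
  have hW : (B * S * B).PosSemidef := by
    have := hS.mul_mul_conjTranspose_same B
    rwa [hBpos.isHermitian.eq] at this
  set C := CFC.sqrt (B * S * B) with hC
  have hCC : C * C = B * S * B := CFC.sqrt_mul_sqrt_self _ hW.nonneg
  have hCpos : C.PosSemidef := 
    Matrix.nonneg_iff_posSemidef.1 (CFC.sqrt_nonneg (B * S * B))
  refine ⟨?_, B⁻¹ * (hCpos.isHermitian.eigenvectorUnitary : Matrix (Fin d) (Fin d) ℝ),
    hCpos.isHermitian.eigenvalues, ?_, hCpos.eigenvalues_nonneg, ?_⟩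
  · calc B⁻¹ * C * B * (B⁻¹ * C * B) = B⁻¹ * C * (B * B⁻¹) * C * B := by
          simp only [Matrix.mul_assoc]
      _ = B⁻¹ * (C * C) * B := by
          rw [Matrix.mul_nonsing_inv B hBdet, Matrix.mul_one]; simp only [Matrix.mul_assoc]
      _ = (B⁻¹ * B) * S * (B * B) := by rw [hCC]; simp only [Matrix.mul_assoc]
      _ = S * T := by rw [Matrix.nonsing_inv_mul B hBdet, Matrix.one_mul, hBB]
  · refine IsUnit.mul ?_ ?_
    · exact (Matrix.isUnit_nonsing_inv_iff).2 hBu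
    · exact Unitary.isUnit_coe
  · have hd : C * (hCpos.isHermitian.eigenvectorUnitary : Matrix (Fin d) (Fin d) ℝ) =
        (hCpos.isHermitian.eigenvectorUnitary : Matrix (Fin d) (Fin d) ℝ) *
          Matrix.diagonal hCpos.isHermitian.eigenvalues := by
      ext i j
      have := congrFun (hCpos.isHermitian.mulVec_eigenvectorBasis j) i
      simp only [Matrix.mulVec, dotProduct, Pi.smul_apply, smul_eq_mul] at this
      rw [Matrix.mul_diagonal, Matrix.mul_apply, mul_comm]
      exact this
    calc B⁻¹ * C * B * (B⁻¹ * (hCpos.isHermitian.eigenvectorUnitary : Matrix (Fin d) (Fin d) ℝ))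
        = B⁻¹ * C * (B * B⁻¹) * (hCpos.isHermitian.eigenvectorUnitary : Matrix _ _ ℝ) := by
          simp only [Matrix.mul_assoc]
      _ = B⁻¹ * (C * (hCpos.isHermitian.eigenvectorUnitary : Matrix _ _ ℝ)) := by
          rw [Matrix.mul_nonsing_inv B hBdet, Matrix.mul_one]; simp only [Matrix.mul_assoc]
      _ = _ := by rw [hd]; simp only [Matrix.mul_assoc]

open Classical in
/-- The principal square root `A^{1/2}` of a square matrix (`0` if there is none). -/
noncomputable def principalSqrt {d : ℕ} (A : Matrix (Fin d) (Fin d) ℝ) :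
    Matrix (Fin d) (Fin d) ℝ :=
  if h : ∃ R, IsPrincipalSqrt A R then h.choose else 0

theorem principalSqrt_eq {d : ℕ} {A R : Matrix (Fin d) (Fin d) ℝ} (h : IsPrincipalSqrt A R) :
    principalSqrt A = R := by
  have hex : ∃ R, IsPrincipalSqrt A R := ⟨R, h⟩
  rw [principalSqrt, dif_pos hex]
  exact hex.choose_spec.unique h

/-- The Fréchet distance between `(μ₁, S₁)` and `(μ₂, S₂)`,
`‖μ₁ - μ₂‖² + Tr[S₁ + S₂ - 2 (S₁ S₂)^{1/2}]`. -/
noncomputable def frechetDist {d : ℕ} (μ₁ : EuclideanSpace ℝ (Fin d))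
    (S₁ : Matrix (Fin d) (Fin d) ℝ) (μ₂ : EuclideanSpace ℝ (Fin d))
    (S₂ : Matrix (Fin d) (Fin d) ℝ) : ℝ :=
  ‖μ₁ - μ₂‖ ^ 2 + (S₁ + S₂ - (2 : ℝ) • principalSqrt (S₁ * S₂)).trace

/-- The sample mean of `n` vectors. -/
noncomputable def sampleMean {d n : ℕ} (y : Fin n → EuclideanSpace ℝ (Fin d)) :
    EuclideanSpace ℝ (Fin d) :=
  (1 / (n : ℝ)) • ∑ i, y i

/-- The empirical covariance matrix of `n` vectors, normalized by `1 / n`. -/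
noncomputable def sampleCov {d n : ℕ} (y : Fin n → EuclideanSpace ℝ (Fin d)) :
    Matrix (Fin d) (Fin d) ℝ :=
  (1 / (n : ℝ)) • ∑ i, Matrix.vecMulVec (y i - sampleMean y).ofLp (y i - sampleMean y).ofLp

/-- The empirical Fréchet distance between `n` generated features and the real data. -/
noncomputable def empiricalFrechetDist {d n : ℕ} (y : Fin n → EuclideanSpace ℝ (Fin d))
    (μr : EuclideanSpace ℝ (Fin d)) (Sr : Matrix (Fin d) (Fin d) ℝ) : ℝ :=
  frechetDist (sampleMean y) (sampleCov y) μr Sr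

/-- The spectral norm of a matrix (operator norm for the Euclidean norm). -/
noncomputable def spectralNorm {d : ℕ} (S : Matrix (Fin d) (Fin d) ℝ) : ℝ :=
  ‖Matrix.toEuclideanCLM (n := Fin d) (𝕜 := ℝ) S‖

/-- The effective rank `Tr[S] / ‖S‖₂` (equal to `0` for `S = 0`). -/
noncomputable def effectiveRank {d : ℕ} (S : Matrix (Fin d) (Fin d) ℝ) : ℝ :=
  S.trace / spectralNorm S

/-- The sub-Gaussian norm `‖Z‖_{ψ₂} = inf {t > 0 : E[exp(Z² / t²)] ≤ 2}`, which is `⊤` if there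
is no such `t`. -/
noncomputable def psiTwoNorm {α : Type*} [MeasurableSpace α] (p : Measure α) (Z : α → ℝ) :
    ENNReal :=
  ⨅ (t : ℝ) (_ : 0 < t ∧ ∫⁻ a, ENNReal.ofReal (Real.exp (Z a ^ 2 / t ^ 2)) ∂p ≤ 2),
    ENNReal.ofReal t

/-- The random vector `W` with covariance matrix `S` is sub-Gaussian with constant `κ`:
`‖yᵀ W‖_{ψ₂} ≤ κ (yᵀ S y)^{1/2}` for every vector `y`. -/
def SubGaussianConst {d : ℕ} {α : Type*} [MeasurableSpace α] (p : Measure α)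
    (W : α → EuclideanSpace ℝ (Fin d)) (S : Matrix (Fin d) (Fin d) ℝ) (κ : ℝ) : Prop :=
  ∀ y : EuclideanSpace ℝ (Fin d),
    psiTwoNorm p (fun a => inner ℝ y (W a)) ≤
      ENNReal.ofReal (κ * Real.sqrt (y.ofLp ⬝ᵥ S.mulVec y.ofLp))

/-- The error radius `Δ_μ` of the sample mean. -/
noncomputable def meanRadius {d : ℕ} (S : Matrix (Fin d) (Fin d) ℝ) (n : ℕ) (δ : ℝ) : ℝ :=
  Real.sqrt ((1 / (n : ℝ)) * (Real.sqrt (8 * (S ^ 2).trace * Real.log (6 / δ))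
    + 8 * spectralNorm S * Real.log (6 / δ)))

/-- The error radius `Δ_Σ` of the empirical covariance matrix. -/
noncomputable def covRadius {d : ℕ} (S : Matrix (Fin d) (Fin d) ℝ) (κ : ℝ) (n : ℕ) (δ : ℝ) : ℝ :=
  20 * κ ^ 2 * spectralNorm S * Real.sqrt ((4 * effectiveRank S + Real.log (3 / δ)) / n)
    + meanRadius S n δ ^ 2

/-- The bonus `B`. Its arguments are the observed features `y`, the mean `μr` and covariance `Sr`
of the real data, the covariance matrix `Sg` of the generator, `κ`, and the failure
probability `δ`. -/
noncomputable def bonus {d n : ℕ} (y : Fin n → EuclideanSpace ℝ (Fin d))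
    (μr : EuclideanSpace ℝ (Fin d)) (Sr Sg : Matrix (Fin d) (Fin d) ℝ) (κ δ : ℝ) : ℝ :=
  2 * meanRadius Sg n δ * (meanRadius Sg n δ + ‖sampleMean y - μr‖)
    + (CFC.sqrt Sr).trace * Real.sqrt (8 * covRadius Sg κ n δ)
    + Sg.trace * Real.sqrt (8 / n * Real.log (6 / δ))
    + 8 * spectralNorm Sg / n * Real.log (6 / δ)

end FrechetOnline

namespace FrechetOnline

/-! ### One-dimensional Gaussian integrals -/

/-! Only one-sided deviations matter. Write `m` for the sample mean and expand `‖m - μr‖²` around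
`μg`. The term `‖m - μg‖²` that appears cancels exactly against the one in the trace of the
empirical covariance (`trace_sampleCov`). What remains is the linear term `2⟪μg - μr, m - μg⟫`, the
excess of the average of `‖y i - μg‖²` over `Tr Sg`, and the loss in the trace of the square root.
The first is a one-dimensional Gaussian tail and the second a sub-gamma tail.

For the third, `Tr (S T)^{1/2}` equals `Tr (T^{1/2} S T^{1/2})^{1/2}`, and a variational formula for
traces of square roots (`two_mul_trace_le`) shows that `Sg ≤ Ŝ + ε` costs at most `ε^{1/2} Tr
Sr^{1/2}`. Hence only a lower tail of the empirical covariance `Ŝ` is needed, uniformly over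
directions.

That lower tail comes from a PAC-Bayes argument. For a fixed direction `θ`, `exp (lowerTailExponent
S l w θ)` has mean at most 1. Averaging `θ` over a standard Gaussian keeps this bound, and Markov's
inequality controls the average on one event. By the Cameron-Martin formula and Jensen's inequality,
this average dominates `exp` of the mean exponent around any centre `a`, at the price `‖a‖² / 2`
(`exp_integral_shift_le`). So a single event serves all `a` at once. The smoothing adds `n Tr S - ∑
‖w i‖²`, which the tail of the squared norms controls. Taking `‖a‖²` to be twice the effective rank
balances smoothing noise and entropy.

This gives `ε = 40 ‖Sg‖ ρ`, where `ρ² = (4 r + log (3/δ)) / n ≤ 1` and `r` is the effective rank.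
Since a Gaussian vector with `Sg ≠ 0` forces `κ ≥ 1`, `ε` is at most twice the covariance radius.
Four events of probability at most `δ / 6` each are discarded. -/

theorem integrable_exp_mul_sq_gaussianReal {a : ℝ} (ha : a < 1 / 2) :
    Integrable (fun x : ℝ => Real.exp (a * x ^ 2)) (gaussianReal 0 1) := by
  rw [gaussianReal_of_var_ne_zero 0 one_ne_zero,
    integrable_withDensity_iff (measurable_gaussianPDF 0 1)
      (Filter.Eventually.of_forall fun x => gaussianPDF_lt_top)]
  have h := (integrable_exp_neg_mul_sq (b := 1 / 2 - a) (by linarith)).const_mul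
    ((√(2 * Real.pi))⁻¹)
  refine h.congr (Filter.Eventually.of_forall fun x => ?_)
  simp only [toReal_gaussianPDF, gaussianPDFReal, NNReal.coe_one, mul_one, sub_zero]
  rw [mul_left_comm, ← Real.exp_add]
  congr 2
  ring

theorem integral_exp_mul_sq_gaussianReal {a : ℝ} (ha : a < 1 / 2) :
    ∫ x, Real.exp (a * x ^ 2) ∂(gaussianReal 0 1) = (√(1 - 2 * a))⁻¹ := by
  rw [integral_gaussianReal_eq_integral_smul one_ne_zero]
  have h : ∀ x : ℝ, gaussianPDFReal 0 1 x • Real.exp (a * x ^ 2) =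
      (√(2 * Real.pi))⁻¹ * Real.exp (-(1 / 2 - a) * x ^ 2) := by
    intro x
    simp only [gaussianPDFReal, NNReal.coe_one, mul_one, sub_zero, smul_eq_mul]
    rw [mul_assoc, ← Real.exp_add]
    congr 2
    ring
  simp_rw [h]
  rw [integral_const_mul, integral_gaussian, ← Real.sqrt_inv, ← Real.sqrt_inv,
    ← Real.sqrt_mul (by positivity)]
  congr 1
  have : (1 - 2 * a) ≠ 0 := by linarith
  have : (1 / 2 - a) ≠ 0 := by linarith
  field_simp

/-- The logarithmic moment generating function of `Z ^ 2 - 1`, for `Z` standard Gaussian, is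
sub-gamma. -/
theorem integral_exp_mul_sq_gaussianReal_le {a : ℝ} (ha0 : 0 ≤ a) (ha : a < 1 / 2) :
    ∫ x, Real.exp (a * x ^ 2) ∂(gaussianReal 0 1) ≤ Real.exp (a + a ^ 2 / (1 - 2 * a)) := by
  rw [integral_exp_mul_sq_gaussianReal ha]
  have hx : 0 < 1 - 2 * a := by linarith
  have hs := Real.sqrt_pos.2 hx
  rw [← Real.exp_log (inv_pos.2 hs)]
  apply Real.exp_le_exp.2
  rw [Real.log_inv, Real.log_sqrt hx.le]
  have h0 : 0 ≤ -Real.log (1 - 2 * a) := by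
    have := Real.log_nonpos hx.le (by linarith)
    linarith
  -- With `x = -log (1 - 2a)`, the inequality `x ≤ sinh x` gives the sub-gamma form: `sinh x / 2` is
  -- exactly `a + a² / (1 - 2a)`.
  have h1 := Real.self_le_sinh_iff.2 h0
  rw [Real.sinh_eq, neg_neg, Real.exp_neg, Real.exp_log hx] at h1
  have h2 : a + a ^ 2 / (1 - 2 * a) = ((1 - 2 * a)⁻¹ - (1 - 2 * a)) / 2 / 2 := by
    obtain ⟨x, rfl⟩ : ∃ x, a = (1 - x) / 2 := ⟨1 - 2 * a, by ring⟩
    have hx' : 1 - 2 * ((1 - x) / 2) = x := by ring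
    rw [hx'] at hx ⊢
    field_simp
    ring
  rw [h2]
  linarith

/-- The Laplace transform of the square of a centered Gaussian variable. -/
theorem integral_exp_neg_mul_sq_gaussianReal_le (v : NNReal) {l : ℝ} (hl : 0 ≤ l) :
    ∫ x, Real.exp (-(l * x ^ 2)) ∂(gaussianReal 0 v) ≤
      Real.exp (-(l * v - l ^ 2 * (v : ℝ) ^ 2)) := by
  have h1 : gaussianReal 0 v = (gaussianReal 0 1).map (fun x => √(v : ℝ) * x) := by
    rw [gaussianReal_map_const_mul]
    congr 1
    · simp
    · ext
      simp
  rw [h1, integral_map (by fun_prop) (by fun_prop)]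
  have h2 : ∀ x : ℝ, Real.exp (-(l * (√(v : ℝ) * x) ^ 2)) = Real.exp (-(l * v) * x ^ 2) := by
    intro x
    rw [mul_pow, Real.sq_sqrt (NNReal.coe_nonneg v)]
    congr 1
    ring
  simp_rw [h2]
  have hy : 0 ≤ l * (v : ℝ) := mul_nonneg hl v.2
  rw [integral_exp_mul_sq_gaussianReal (by linarith)]
  have hx : 0 < 1 - 2 * -(l * (v : ℝ)) := by linarith
  rw [← Real.exp_log (inv_pos.2 (Real.sqrt_pos.2 hx))]
  apply Real.exp_le_exp.2
  rw [Real.log_inv, Real.log_sqrt hx.le]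
  -- With `u = 2lv`, the bound used is `log (1 + u) ≥ 2u / (u + 2) ≥ u - u² / 2`.
  have h3 := Real.le_log_one_add_of_nonneg (x := 2 * (l * v)) (by linarith)
  have h4 : 2 * (l * (v : ℝ)) - (2 * (l * v)) ^ 2 / 2 ≤
      2 * (2 * (l * v)) / (2 * (l * v) + 2) := by
    rw [le_div_iff₀ (by linarith)]
    nlinarith [mul_nonneg hy (sq_nonneg (l * (v : ℝ)))]
  have h5 : 1 - 2 * -(l * (v : ℝ)) = 1 + 2 * (l * v) := by ring
  rw [h5]
  nlinarith

/-- One-dimensional Cameron-Martin formula: the weight turns the density at `x` into the density at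
`x + a`, and Lebesgue measure is translation invariant. -/
theorem integral_shift_gaussianReal {E : Type*} [NormedAddCommGroup E] [NormedSpace ℝ E]
    (a : ℝ) (g : ℝ → E) :
    ∫ x, Real.exp (-(a * x) - a ^ 2 / 2) • g (x + a) ∂(gaussianReal 0 1) =
      ∫ x, g x ∂(gaussianReal 0 1) := by
  rw [integral_gaussianReal_eq_integral_smul one_ne_zero,
    integral_gaussianReal_eq_integral_smul one_ne_zero,
    ← integral_add_right_eq_self (fun x => gaussianPDFReal 0 1 x • g x) a]
  congr 1
  ext x
  rw [smul_smul]
  congr 1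
  simp only [gaussianPDFReal, NNReal.coe_one, mul_one, sub_zero]
  rw [mul_assoc, ← Real.exp_add]
  congr 2
  ring

theorem integrable_pow_gaussianReal (k : ℕ) :
    Integrable (fun x : ℝ => x ^ k) (gaussianReal 0 1) := by
  have := (memLp_id_gaussianReal' (μ := 0) (v := 1) (k : ENNReal) (by simp)).integrable_norm_pow'
  rw [← integrable_norm_iff (by fun_prop)]
  simpa using this

theorem integral_sq_gaussianReal : ∫ x, x ^ 2 ∂(gaussianReal 0 1) = 1 := by
  have := variance_fun_id_gaussianReal (μ := 0) (v := 1)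
  rw [variance_of_integral_eq_zero (by fun_prop) integral_id_gaussianReal] at this
  simpa using this

/-- A crude bound suffices. The rate `3/8` makes the exponential moment equal to 2, and the
quadratic Taylor minorant of `exp` then leaves at most `80/9`. -/
theorem integral_pow_four_gaussianReal_le : ∫ x, x ^ 4 ∂(gaussianReal 0 1) ≤ 9 := by
  have h1 : ∫ x, (1 + 3 / 8 * x ^ 2 + 9 / 128 * x ^ 4) ∂(gaussianReal 0 1) ≤
      ∫ x, Real.exp (3 / 8 * x ^ 2) ∂(gaussianReal 0 1) := by
    refine integral_mono ?_ (integrable_exp_mul_sq_gaussianReal (by norm_num)) fun x => ?_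
    · exact ((integrable_const _).add ((integrable_pow_gaussianReal 2).const_mul _)).add
        ((integrable_pow_gaussianReal 4).const_mul _)
    · have := Real.quadratic_le_exp_of_nonneg (x := 3 / 8 * x ^ 2) (by positivity)
      dsimp only
      nlinarith
  rw [integral_exp_mul_sq_gaussianReal (by norm_num), integral_add, integral_add,
    integral_const_mul, integral_const_mul, integral_sq_gaussianReal] at h1
  · have h2 : √(1 - 2 * (3 / 8 : ℝ)) = 1 / 2 := by
      rw [show (1 - 2 * (3 / 8 : ℝ)) = (1 / 2) ^ 2 by norm_num, Real.sqrt_sq (by norm_num)]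
    rw [h2] at h1
    simp at h1
    linarith
  · exact integrable_const _
  · exact (integrable_pow_gaussianReal 2).const_mul _
  · exact (integrable_const _).add ((integrable_pow_gaussianReal 2).const_mul _)
  · exact (integrable_pow_gaussianReal 4).const_mul _

/-! ### The quadratic form of a positive semidefinite matrix -/

/-- The quadratic form `θᵀ S θ`. -/
noncomputable def quadForm {d : ℕ} (S : Matrix (Fin d) (Fin d) ℝ)
    (θ : EuclideanSpace ℝ (Fin d)) : ℝ :=
  inner ℝ θ (Matrix.toEuclideanCLM (n := Fin d) (𝕜 := ℝ) S θ)

theorem quadForm_eq {d : ℕ} (S : Matrix (Fin d) (Fin d) ℝ) (θ : EuclideanSpace ℝ (Fin d)) :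
    quadForm S θ = θ.ofLp ⬝ᵥ S *ᵥ θ.ofLp :=
  Matrix.inner_toEuclideanCLM S θ θ

theorem continuous_quadForm {d : ℕ} (S : Matrix (Fin d) (Fin d) ℝ) : Continuous (quadForm S) := by
  unfold quadForm
  fun_prop

theorem quadForm_le {d : ℕ} (S : Matrix (Fin d) (Fin d) ℝ) (θ : EuclideanSpace ℝ (Fin d)) :
    quadForm S θ ≤ spectralNorm S * ‖θ‖ ^ 2 := by
  have h1 := real_inner_le_norm θ (Matrix.toEuclideanCLM (n := Fin d) (𝕜 := ℝ) S θ)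
  have h2 := (Matrix.toEuclideanCLM (n := Fin d) (𝕜 := ℝ) S).le_opNorm θ
  have h3 := mul_le_mul_of_nonneg_left h2 (norm_nonneg θ)
  unfold quadForm spectralNorm
  nlinarith

theorem quadForm_nonneg {d : ℕ} {S : Matrix (Fin d) (Fin d) ℝ} (hS : S.PosSemidef)
    (θ : EuclideanSpace ℝ (Fin d)) : 0 ≤ quadForm S θ := by
  rw [quadForm_eq]
  exact hS.dotProduct_mulVec_nonneg θ.ofLp

theorem spectralNorm_nonneg {d : ℕ} (S : Matrix (Fin d) (Fin d) ℝ) : 0 ≤ spectralNorm S :=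
  norm_nonneg _

theorem quadForm_smul {d : ℕ} (S : Matrix (Fin d) (Fin d) ℝ) (c : ℝ)
    (θ : EuclideanSpace ℝ (Fin d)) : quadForm S (c • θ) = c ^ 2 * quadForm S θ := by
  unfold quadForm
  rw [map_smul, inner_smul_left, inner_smul_right]
  simp only [conj_trivial]
  ring

theorem quadForm_add_add_quadForm_sub {d : ℕ} (S : Matrix (Fin d) (Fin d) ℝ)
    (x y : EuclideanSpace ℝ (Fin d)) :
    quadForm S (x + y) + quadForm S (x - y) = 2 * quadForm S x + 2 * quadForm S y := by
  unfold quadForm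
  simp only [map_add, map_sub, inner_add_left, inner_add_right, inner_sub_left, inner_sub_right]
  ring

/-- Spectral decomposition of the quadratic form of a positive semidefinite matrix. -/
theorem exists_eigenbasis {d : ℕ} {S : Matrix (Fin d) (Fin d) ℝ} (hS : S.PosSemidef) :
    ∃ (b : OrthonormalBasis (Fin d) ℝ (EuclideanSpace ℝ (Fin d))) (l : Fin d → ℝ),
      (∀ k, 0 ≤ l k) ∧ (∀ k, l k ≤ spectralNorm S) ∧
      (∀ k, Matrix.toEuclideanCLM (n := Fin d) (𝕜 := ℝ) S (b k) = l k • b k) ∧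
      (∀ θ, quadForm S θ = ∑ k, l k * inner ℝ (b k) θ ^ 2) ∧
      S.trace = ∑ k, l k ∧ (S ^ 2).trace = ∑ k, l k ^ 2 := by
  have hH := hS.isHermitian
  have hb : ∀ k, Matrix.toEuclideanCLM (n := Fin d) (𝕜 := ℝ) S (hH.eigenvectorBasis k) =
      hH.eigenvalues k • hH.eigenvectorBasis k := by
    intro k
    ext i
    have := congrFun (hH.mulVec_eigenvectorBasis k) i
    simpa using this
  have hsa : IsSelfAdjoint (Matrix.toEuclideanCLM (n := Fin d) (𝕜 := ℝ) S) :=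
    IsSelfAdjoint.map (f := Matrix.toEuclideanCLM (n := Fin d) (𝕜 := ℝ)) hH
  have hq : ∀ θ, quadForm S θ = ∑ k, hH.eigenvalues k * inner ℝ (hH.eigenvectorBasis k) θ ^ 2 := by
    intro θ
    unfold quadForm
    rw [← hH.eigenvectorBasis.sum_inner_mul_inner]
    refine Finset.sum_congr rfl fun k _ => ?_
    have h1 : inner ℝ (hH.eigenvectorBasis k)
        (Matrix.toEuclideanCLM (n := Fin d) (𝕜 := ℝ) S θ) =
        inner ℝ (Matrix.toEuclideanCLM (n := Fin d) (𝕜 := ℝ) S (hH.eigenvectorBasis k)) θ := by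
      rw [← ContinuousLinearMap.adjoint_inner_left, hsa.adjoint_eq]
    rw [h1, hb, inner_smul_left, real_inner_comm]
    simp only [conj_trivial]
    ring
  refine ⟨hH.eigenvectorBasis, hH.eigenvalues, hS.eigenvalues_nonneg, fun k => ?_, hb, hq, ?_, ?_⟩
  · have h1 := quadForm_le S (hH.eigenvectorBasis k)
    unfold quadForm at h1
    rw [hb, inner_smul_right, real_inner_self_eq_norm_sq] at h1
    simpa using h1
  · simpa using hH.trace_eq_sum_eigenvalues
  · conv_lhs => rw [hH.spectral_theorem, ← map_pow, Matrix.diagonal_pow]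
    rw [Unitary.conjStarAlgAut_apply, Matrix.trace_mul_cycle, Unitary.coe_star_mul_self, one_mul,
      Matrix.trace_diagonal]
    simp

theorem spectralNorm_le_trace {d : ℕ} {S : Matrix (Fin d) (Fin d) ℝ} (hS : S.PosSemidef) :
    spectralNorm S ≤ S.trace := by
  obtain ⟨b, l, hl0, -, hb, -, hT, -⟩ := exists_eigenbasis hS
  have hT0 : 0 ≤ S.trace := hS.trace_nonneg
  refine ContinuousLinearMap.opNorm_le_bound _ hT0 fun x => ?_
  have hx : Matrix.toEuclideanCLM (n := Fin d) (𝕜 := ℝ) S x =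
      ∑ k, (l k * inner ℝ (b k) x) • b k := by
    conv_lhs => rw [← b.sum_repr' x]
    rw [map_sum]
    refine Finset.sum_congr rfl fun k _ => ?_
    rw [map_smul, hb, smul_smul, mul_comm]
  rw [hx]
  refine (norm_sum_le _ _).trans ?_
  rw [hT, Finset.sum_mul]
  refine Finset.sum_le_sum fun k _ => ?_
  rw [norm_smul, b.norm_eq_one, mul_one, norm_mul, Real.norm_of_nonneg (hl0 k)]
  refine mul_le_mul_of_nonneg_left ?_ (hl0 k)
  simpa using norm_inner_le_norm (𝕜 := ℝ) (b k) x

theorem trace_sq_nonneg {d : ℕ} {S : Matrix (Fin d) (Fin d) ℝ} (hS : S.PosSemidef) :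
    0 ≤ (S ^ 2).trace := by
  obtain ⟨b, l, -, -, -, -, -, hV⟩ := exists_eigenbasis hS
  rw [hV]
  exact Finset.sum_nonneg fun k _ => sq_nonneg _

theorem trace_sq_le {d : ℕ} {S : Matrix (Fin d) (Fin d) ℝ} (hS : S.PosSemidef) :
    (S ^ 2).trace ≤ S.trace ^ 2 := by
  obtain ⟨b, l, hl0, -, -, -, hT, hV⟩ := exists_eigenbasis hS
  rw [hV, hT]
  exact Finset.sum_sq_le_sq_sum_of_nonneg fun k _ => hl0 k

theorem trace_sq_pos {d : ℕ} {S : Matrix (Fin d) (Fin d) ℝ} (hS : S.PosSemidef) (h0 : S ≠ 0) :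
    0 < (S ^ 2).trace := by
  refine lt_of_le_of_ne (trace_sq_nonneg hS) fun h => h0 ?_
  obtain ⟨b, l, hl0, -, -, -, hT, hV⟩ := exists_eigenbasis hS
  rw [hV, eq_comm, Finset.sum_eq_zero_iff_of_nonneg fun k _ => sq_nonneg _] at h
  rw [← hS.trace_eq_zero_iff, hT]
  exact Finset.sum_eq_zero fun k hk => pow_eq_zero_iff two_ne_zero |>.1 (h k hk)

theorem spectralNorm_pos {d : ℕ} {S : Matrix (Fin d) (Fin d) ℝ} (h0 : S ≠ 0) :
    0 < spectralNorm S := by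
  unfold spectralNorm
  rw [norm_pos_iff]
  intro h
  exact h0 ((map_eq_zero_iff _ (Matrix.toEuclideanCLM (n := Fin d) (𝕜 := ℝ)).injective).1 h)

/-! ### Standard Gaussian vectors -/

theorem integral_stdGaussian_basis {d : ℕ} {F : Type*} [NormedAddCommGroup F] [NormedSpace ℝ F]
    (b : OrthonormalBasis (Fin d) ℝ (EuclideanSpace ℝ (Fin d))) {g : EuclideanSpace ℝ (Fin d) → F}
    (hg : AEStronglyMeasurable g (stdGaussian (EuclideanSpace ℝ (Fin d)))) :
    ∫ θ, g θ ∂(stdGaussian (EuclideanSpace ℝ (Fin d))) =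
      ∫ x, g (∑ i, x i • b i) ∂(Measure.pi fun _ : Fin d => gaussianReal 0 1) := by
  rw [stdGaussian_eq_map_pi_orthonormalBasis b] at hg ⊢
  rw [integral_map (Measurable.aemeasurable (by fun_prop)) hg]

theorem integrable_stdGaussian_basis {d : ℕ} {F : Type*} [NormedAddCommGroup F]
    (b : OrthonormalBasis (Fin d) ℝ (EuclideanSpace ℝ (Fin d))) {g : EuclideanSpace ℝ (Fin d) → F}
    (hg : AEStronglyMeasurable g (stdGaussian (EuclideanSpace ℝ (Fin d)))) :
    Integrable g (stdGaussian (EuclideanSpace ℝ (Fin d))) ↔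
      Integrable (fun x => g (∑ i, x i • b i))
        (Measure.pi fun _ : Fin d => gaussianReal 0 1) := by
  rw [stdGaussian_eq_map_pi_orthonormalBasis b] at hg ⊢
  rw [integrable_map_measure hg (Measurable.aemeasurable (by fun_prop))]
  rfl

theorem inner_basis_sum {d : ℕ} (b : OrthonormalBasis (Fin d) ℝ (EuclideanSpace ℝ (Fin d)))
    (x : Fin d → ℝ) (k : Fin d) : inner ℝ (b k) (∑ i, x i • b i) = x k := by
  simp [inner_sum, inner_smul_right, b.inner_eq_ite]

/-- Coordinates of a standard Gaussian vector are standard Gaussian. -/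
theorem integral_inner_basis_stdGaussian {d : ℕ}
    (b : OrthonormalBasis (Fin d) ℝ (EuclideanSpace ℝ (Fin d))) (k : Fin d) {g : ℝ → ℝ}
    (hg : Continuous g) :
    ∫ θ, g (inner ℝ (b k) θ) ∂(stdGaussian (EuclideanSpace ℝ (Fin d))) =
      ∫ x, g x ∂(gaussianReal 0 1) := by
  rw [integral_stdGaussian_basis b
    (Continuous.aestronglyMeasurable (by fun_prop))]
  simp_rw [inner_basis_sum]
  exact integral_comp_eval (μ := fun _ : Fin d => gaussianReal 0 1) hg.aestronglyMeasurable

theorem integrable_inner_basis_stdGaussian {d : ℕ}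
    (b : OrthonormalBasis (Fin d) ℝ (EuclideanSpace ℝ (Fin d))) (k : Fin d) {g : ℝ → ℝ}
    (hg : Continuous g) (hi : Integrable g (gaussianReal 0 1)) :
    Integrable (fun θ => g (inner ℝ (b k) θ)) (stdGaussian (EuclideanSpace ℝ (Fin d))) := by
  rw [integrable_stdGaussian_basis b (Continuous.aestronglyMeasurable (by fun_prop))]
  simp_rw [inner_basis_sum]
  exact integrable_comp_eval (μ := fun _ : Fin d => gaussianReal 0 1) hi

theorem integrable_exp_inner_stdGaussian {d : ℕ} (a : EuclideanSpace ℝ (Fin d)) (c : ℝ) :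
    Integrable (fun θ => Real.exp (-inner ℝ a θ - c))
      (stdGaussian (EuclideanSpace ℝ (Fin d))) := by
  have h : Integrable (fun x : ℝ => Real.exp (-x - c))
      ((stdGaussian (EuclideanSpace ℝ (Fin d))).map (innerSL ℝ a)) := by
    rw [IsGaussian.map_eq_gaussianReal]
    refine ((integrable_exp_mul_gaussianReal (-1)).mul_const (Real.exp (-c))).congr
      (Filter.Eventually.of_forall fun x => ?_)
    dsimp only
    rw [← Real.exp_add]
    congr 1
    ring
  exact h.comp_measurable (by fun_prop)

/-- The Cameron-Martin formula for the standard Gaussian measure, as an equality of measures. -/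
theorem map_add_withDensity_stdGaussian {d : ℕ} (a : EuclideanSpace ℝ (Fin d)) :
    ((stdGaussian (EuclideanSpace ℝ (Fin d))).withDensity fun θ =>
      ENNReal.ofReal (Real.exp (-inner ℝ a θ - ‖a‖ ^ 2 / 2))).map (· + a) =
      stdGaussian (EuclideanSpace ℝ (Fin d)) := by
  have hfin := isFiniteMeasure_withDensity_ofReal
    (integrable_exp_inner_stdGaussian a (‖a‖ ^ 2 / 2)).2
  apply Measure.ext_of_charFun
  ext t
  rw [charFun_apply, charFun_apply, integral_map (by fun_prop)
    (Continuous.aestronglyMeasurable (by fun_prop)),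
    integral_withDensity_eq_integral_toReal_smul₀ (by fun_prop)
      (Filter.Eventually.of_forall fun θ => ENNReal.ofReal_lt_top)]
  simp_rw [ENNReal.toReal_ofReal (Real.exp_pos _).le]
  let b := EuclideanSpace.basisFun (Fin d) ℝ
  rw [integral_stdGaussian_basis b (Continuous.aestronglyMeasurable (by fun_prop)),
    integral_stdGaussian_basis b (Continuous.aestronglyMeasurable (by fun_prop))]
  -- In orthonormal coordinates both characteristic functions factor, so the identity reduces to
  -- one-dimensional shifts.
  have h1 : ∀ x : Fin d → ℝ, Complex.exp ((inner ℝ (∑ i, x i • b i) t : ℝ) * Complex.I) =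
      ∏ i, Complex.exp ((x i * inner ℝ (b i) t : ℝ) * Complex.I) := by
    intro x
    rw [← Complex.exp_sum, sum_inner, ← Finset.sum_mul]
    simp [inner_smul_left]
  have h2 : ∀ x : Fin d → ℝ,
      Real.exp (-inner ℝ a (∑ i, x i • b i) - ‖a‖ ^ 2 / 2) •
        Complex.exp ((inner ℝ (∑ i, x i • b i + a) t : ℝ) * Complex.I) =
      ∏ i, Real.exp (-(inner ℝ (b i) a * x i) - inner ℝ (b i) a ^ 2 / 2) •
        Complex.exp (((x i + inner ℝ (b i) a) * inner ℝ (b i) t : ℝ) * Complex.I) := by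
    intro x
    have hR : Real.exp (-inner ℝ a (∑ i, x i • b i) - ‖a‖ ^ 2 / 2) =
        ∏ i, Real.exp (-(inner ℝ (b i) a * x i) - inner ℝ (b i) a ^ 2 / 2) := by
      rw [← Real.exp_sum, Finset.sum_sub_distrib, ← Finset.sum_div, b.sum_sq_inner_right,
        Finset.sum_neg_distrib, inner_sum]
      have : ∑ i, inner ℝ a (x i • b i) = ∑ i, inner ℝ (b i) a * x i :=
        Finset.sum_congr rfl fun i _ => by rw [inner_smul_right, real_inner_comm, mul_comm]
      rw [this]
    have hC : Complex.exp ((inner ℝ (∑ i, x i • b i + a) t : ℝ) * Complex.I) =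
        ∏ i, Complex.exp (((x i + inner ℝ (b i) a) * inner ℝ (b i) t : ℝ) * Complex.I) := by
      rw [← Complex.exp_sum, ← Finset.sum_mul, ← Complex.ofReal_sum]
      congr 3
      simp_rw [add_mul]
      rw [inner_add_left, sum_inner, Finset.sum_add_distrib, ← b.sum_inner_mul_inner a t]
      simp [inner_smul_left, real_inner_comm]
    rw [hR, hC]
    simp only [Complex.real_smul, Complex.ofReal_prod, Finset.prod_mul_distrib]
  simp_rw [h1, h2]
  rw [integral_fintype_prod_eq_prod
      (f := fun i x => Real.exp (-(inner ℝ (b i) a * x) - inner ℝ (b i) a ^ 2 / 2) •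
        Complex.exp (((x + inner ℝ (b i) a) * inner ℝ (b i) t : ℝ) * Complex.I)),
    integral_fintype_prod_eq_prod
      (f := fun i x => Complex.exp ((x * inner ℝ (b i) t : ℝ) * Complex.I))]
  exact Finset.prod_congr rfl fun i _ => integral_shift_gaussianReal _
    (fun x => Complex.exp ((x * inner ℝ (b i) t : ℝ) * Complex.I))

theorem integral_shift_stdGaussian {d : ℕ} (a : EuclideanSpace ℝ (Fin d))
    {g : EuclideanSpace ℝ (Fin d) → ℝ} (hg : Continuous g) :
    ∫ θ, Real.exp (-inner ℝ a θ - ‖a‖ ^ 2 / 2) * g (θ + a)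
      ∂(stdGaussian (EuclideanSpace ℝ (Fin d))) =
      ∫ θ, g θ ∂(stdGaussian (EuclideanSpace ℝ (Fin d))) := by
  conv_rhs => rw [← map_add_withDensity_stdGaussian a]
  rw [integral_map (by fun_prop) hg.aestronglyMeasurable,
    integral_withDensity_eq_integral_toReal_smul₀ (by fun_prop)
      (Filter.Eventually.of_forall fun θ => ENNReal.ofReal_lt_top)]
  simp_rw [ENNReal.toReal_ofReal (Real.exp_pos _).le]
  rfl

/-- Gaussian smoothing: a lower bound on exponential integrals by averages over a translate,
with the relative entropy `‖a‖² / 2` as the price. -/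
theorem exp_integral_shift_le {d : ℕ} (a : EuclideanSpace ℝ (Fin d))
    {F : EuclideanSpace ℝ (Fin d) → ℝ} (hF : Continuous F) {C : ℝ} (hC : ∀ θ, F θ ≤ C)
    (hint : Integrable (fun θ => F (θ + a)) (stdGaussian (EuclideanSpace ℝ (Fin d)))) :
    Real.exp (∫ θ, F (θ + a) ∂(stdGaussian (EuclideanSpace ℝ (Fin d))) - ‖a‖ ^ 2 / 2) ≤
      ∫ θ, Real.exp (F θ) ∂(stdGaussian (EuclideanSpace ℝ (Fin d))) := by
  rw [← integral_shift_stdGaussian a (by fun_prop : Continuous fun θ => Real.exp (F θ))]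
  simp_rw [← Real.exp_add]
  have hinner : Integrable (fun θ : EuclideanSpace ℝ (Fin d) => -inner ℝ a θ)
      (stdGaussian (EuclideanSpace ℝ (Fin d))) :=
    (IsGaussian.integrable_id.const_inner a).neg
  have hlin : Integrable (fun θ : EuclideanSpace ℝ (Fin d) => -inner ℝ a θ - ‖a‖ ^ 2 / 2)
      (stdGaussian (EuclideanSpace ℝ (Fin d))) := hinner.sub (integrable_const _)
  have h0 : ∫ θ, (-inner ℝ a θ - ‖a‖ ^ 2 / 2 + F (θ + a))
      ∂(stdGaussian (EuclideanSpace ℝ (Fin d))) =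
      ∫ θ, F (θ + a) ∂(stdGaussian (EuclideanSpace ℝ (Fin d))) - ‖a‖ ^ 2 / 2 := by
    rw [integral_add hlin hint, integral_sub hinner (integrable_const _), integral_neg,
      show ∫ θ, inner ℝ a θ ∂(stdGaussian (EuclideanSpace ℝ (Fin d))) = 0 from
        integral_strongDual_stdGaussian (innerSL ℝ a)]
    simp
    ring
  rw [← h0]
  refine ConvexOn.map_integral_le (g := Real.exp) convexOn_exp Real.continuous_exp.continuousOn
    isClosed_univ (by simp) (hlin.add hint) ?_
  -- The upper bound `C` serves only to make the exponential integrable, as Jensen's inequality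
  -- requires.
  have h1 := (integrable_exp_inner_stdGaussian a (‖a‖ ^ 2 / 2)).mul_const (Real.exp C)
  refine h1.mono' (Continuous.aestronglyMeasurable (by fun_prop))
    (Filter.Eventually.of_forall fun θ => ?_)
  simp only [Function.comp_apply]
  rw [Real.norm_of_nonneg (Real.exp_pos _).le, ← Real.exp_add]
  exact Real.exp_le_exp.2 (by linarith [hC (θ + a)])

theorem integrable_quadForm_stdGaussian {d : ℕ} {S : Matrix (Fin d) (Fin d) ℝ}
    (hS : S.PosSemidef) :
    Integrable (quadForm S) (stdGaussian (EuclideanSpace ℝ (Fin d))) := by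
  obtain ⟨b, l, -, -, -, hq, -, -⟩ := exists_eigenbasis hS
  rw [show quadForm S = _ from funext hq]
  exact integrable_finsetSum _ fun k _ => (integrable_inner_basis_stdGaussian b k
    (g := fun x => x ^ 2) (by fun_prop) (integrable_pow_gaussianReal 2)).const_mul _

theorem integral_quadForm_stdGaussian {d : ℕ} {S : Matrix (Fin d) (Fin d) ℝ}
    (hS : S.PosSemidef) :
    ∫ θ, quadForm S θ ∂(stdGaussian (EuclideanSpace ℝ (Fin d))) = S.trace := by
  obtain ⟨b, l, -, -, -, hq, hT, -⟩ := exists_eigenbasis hS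
  simp_rw [hq]
  rw [integral_finsetSum _ fun k _ => (integrable_inner_basis_stdGaussian b k
    (g := fun x => x ^ 2) (by fun_prop) (integrable_pow_gaussianReal 2)).const_mul _, hT]
  refine Finset.sum_congr rfl fun k _ => ?_
  rw [integral_const_mul, integral_inner_basis_stdGaussian b k (g := fun x => x ^ 2)
    (by fun_prop), integral_sq_gaussianReal, mul_one]

/-- Cauchy-Schwarz with weights `l k`; it reduces the second moment of a Gaussian quadratic form to
fourth moments of its coordinates. -/
theorem quadForm_sq_le_sum {d : ℕ} {b : OrthonormalBasis (Fin d) ℝ (EuclideanSpace ℝ (Fin d))}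
    {l : Fin d → ℝ} (hl : ∀ k, 0 ≤ l k) (θ : EuclideanSpace ℝ (Fin d)) :
    (∑ k, l k * inner ℝ (b k) θ ^ 2) ^ 2 ≤ (∑ k, l k) * ∑ k, l k * inner ℝ (b k) θ ^ 4 := by
  refine Finset.sum_sq_le_sum_mul_sum_of_sq_le_mul _ (fun k _ => hl k)
    (fun k _ => mul_nonneg (hl k) (by positivity)) fun k _ => le_of_eq ?_
  ring

theorem integrable_quadForm_sq_stdGaussian {d : ℕ} {S : Matrix (Fin d) (Fin d) ℝ}
    (hS : S.PosSemidef) :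
    Integrable (fun θ => quadForm S θ ^ 2) (stdGaussian (EuclideanSpace ℝ (Fin d))) := by
  obtain ⟨b, l, hl, -, -, hq, -, -⟩ := exists_eigenbasis hS
  have h : Integrable (fun θ => (∑ k, l k) * ∑ k, l k * inner ℝ (b k) θ ^ 4)
      (stdGaussian (EuclideanSpace ℝ (Fin d))) :=
    (integrable_finsetSum _ fun k _ => (integrable_inner_basis_stdGaussian b k
      (g := fun x => x ^ 4) (by fun_prop) (integrable_pow_gaussianReal 4)).const_mul _).const_mul _
  refine h.mono' (((continuous_quadForm S).pow 2).aestronglyMeasurable)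
    (Filter.Eventually.of_forall fun θ => ?_)
  rw [Real.norm_of_nonneg (sq_nonneg _), hq]
  exact quadForm_sq_le_sum hl θ

theorem integral_quadForm_sq_stdGaussian_le {d : ℕ} {S : Matrix (Fin d) (Fin d) ℝ}
    (hS : S.PosSemidef) :
    ∫ θ, quadForm S θ ^ 2 ∂(stdGaussian (EuclideanSpace ℝ (Fin d))) ≤ 9 * S.trace ^ 2 := by
  have hi := integrable_quadForm_sq_stdGaussian hS
  obtain ⟨b, l, hl, -, -, hq, hT, -⟩ := exists_eigenbasis hS
  have h4 : ∀ k ∈ Finset.univ, Integrable (fun θ => l k * inner ℝ (b k) θ ^ 4)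
      (stdGaussian (EuclideanSpace ℝ (Fin d))) := fun k _ =>
    (integrable_inner_basis_stdGaussian b k
      (g := fun x => x ^ 4) (by fun_prop) (integrable_pow_gaussianReal 4)).const_mul _
  have h1 : ∫ θ, quadForm S θ ^ 2 ∂(stdGaussian (EuclideanSpace ℝ (Fin d))) ≤
      ∫ θ, (∑ k, l k) * ∑ k, l k * inner ℝ (b k) θ ^ 4
        ∂(stdGaussian (EuclideanSpace ℝ (Fin d))) := by
    refine integral_mono hi ((integrable_finsetSum _ h4).const_mul _) fun θ => ?_
    dsimp only
    rw [hq]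
    exact quadForm_sq_le_sum hl θ
  refine h1.trans ?_
  rw [integral_const_mul, integral_finsetSum _ h4, ← hT, sq, mul_left_comm]
  refine mul_le_mul_of_nonneg_left ?_ hS.trace_nonneg
  rw [hT, Finset.mul_sum]
  refine Finset.sum_le_sum fun k _ => ?_
  rw [integral_const_mul, integral_inner_basis_stdGaussian b k (g := fun x => x ^ 4)
    (by fun_prop)]
  nlinarith [hl k, integral_pow_four_gaussianReal_le]

/-- The moment generating function of a Gaussian quadratic form is sub-gamma. -/
theorem integrable_exp_quadForm_stdGaussian {d : ℕ} {S : Matrix (Fin d) (Fin d) ℝ}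
    (hS : S.PosSemidef) {s : ℝ} (hs0 : 0 ≤ s) (hs : 2 * s * spectralNorm S < 1) :
    Integrable (fun θ => Real.exp (s * quadForm S θ)) (stdGaussian (EuclideanSpace ℝ (Fin d))) ∧
    ∫ θ, Real.exp (s * quadForm S θ) ∂(stdGaussian (EuclideanSpace ℝ (Fin d))) ≤
      Real.exp (s * S.trace + s ^ 2 * (S ^ 2).trace / (1 - 2 * s * spectralNorm S)) := by
  have hc : AEStronglyMeasurable (fun θ => Real.exp (s * quadForm S θ))
      (stdGaussian (EuclideanSpace ℝ (Fin d))) :=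
    (Real.continuous_exp.comp ((continuous_quadForm S).const_mul s)).aestronglyMeasurable
  obtain ⟨b, l, hl, hlS, -, hq, hT, hV⟩ := exists_eigenbasis hS
  have hsl : ∀ k, s * l k < 1 / 2 := fun k => by
    nlinarith [mul_le_mul_of_nonneg_left (hlS k) hs0]
  have hprod : ∀ x : Fin d → ℝ, Real.exp (s * quadForm S (∑ i, x i • b i)) =
      ∏ k, Real.exp (s * l k * x k ^ 2) := by
    intro x
    rw [hq, Finset.mul_sum, Real.exp_sum]
    simp_rw [inner_basis_sum, mul_assoc]
  constructor
  · rw [integrable_stdGaussian_basis b hc]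
    simp_rw [hprod]
    exact Integrable.fintype_prod (f := fun k x => Real.exp (s * l k * x ^ 2))
      fun k => integrable_exp_mul_sq_gaussianReal (hsl k)
  · rw [integral_stdGaussian_basis b hc]
    simp_rw [hprod]
    rw [integral_fintype_prod_eq_prod (f := fun k x => Real.exp (s * l k * x ^ 2)), hT, hV,
      Finset.mul_sum, Finset.mul_sum, Finset.sum_div, ← Finset.sum_add_distrib, Real.exp_sum]
    refine Finset.prod_le_prod (fun k _ => integral_nonneg fun x => (Real.exp_pos _).le)
      fun k _ => ?_
    refine (integral_exp_mul_sq_gaussianReal_le (mul_nonneg hs0 (hl k)) (hsl k)).trans ?_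
    refine Real.exp_le_exp.2 (add_le_add_right ?_ _)
    rw [mul_pow]
    refine div_le_div_of_nonneg_left (by positivity) (by linarith) ?_
    nlinarith [mul_le_mul_of_nonneg_left (hlS k) hs0]

/-! ### Centered Gaussian vectors with a given covariance matrix -/

/-- Since `N(0, S)` is the image of the standard Gaussian under `S^{1/2}`, this transfers
exponential moments of quadratic forms to squared norms. -/
theorem norm_sqrt_apply_sq {d : ℕ} {S : Matrix (Fin d) (Fin d) ℝ} (hS : S.PosSemidef)
    (θ : EuclideanSpace ℝ (Fin d)) :
    ‖Matrix.toEuclideanCLM (n := Fin d) (𝕜 := ℝ) (CFC.sqrt S) θ‖ ^ 2 = quadForm S θ := by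
  have hsa : IsSelfAdjoint (Matrix.toEuclideanCLM (n := Fin d) (𝕜 := ℝ) (CFC.sqrt S)) :=
    (CFC.sqrt_nonneg S).isSelfAdjoint.map (Matrix.toEuclideanCLM (n := Fin d) (𝕜 := ℝ))
  rw [← real_inner_self_eq_norm_sq, ← ContinuousLinearMap.adjoint_inner_right, hsa.adjoint_eq,
    ← ContinuousLinearMap.comp_apply, ← ContinuousLinearMap.mul_def, ← map_mul,
    CFC.sqrt_mul_sqrt_self S hS.nonneg, quadForm]

theorem integrable_exp_norm_sq_multivariateGaussian {d : ℕ} {S : Matrix (Fin d) (Fin d) ℝ}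
    (hS : S.PosSemidef) {s : ℝ} (hs0 : 0 ≤ s) (hs : 2 * s * spectralNorm S < 1) :
    Integrable (fun w => Real.exp (s * ‖w‖ ^ 2)) (multivariateGaussian 0 S) ∧
    ∫ w, Real.exp (s * ‖w‖ ^ 2) ∂(multivariateGaussian 0 S) ≤
      Real.exp (s * S.trace + s ^ 2 * (S ^ 2).trace / (1 - 2 * s * spectralNorm S)) := by
  have h := integrable_exp_quadForm_stdGaussian hS hs0 hs
  simp_rw [← norm_sqrt_apply_sq hS] at h
  unfold multivariateGaussian
  simp_rw [zero_add]
  rw [integral_map (by fun_prop) (Continuous.aestronglyMeasurable (by fun_prop)),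
    integrable_map_measure (Continuous.aestronglyMeasurable (by fun_prop)) (by fun_prop)]
  exact h

theorem map_inner_multivariateGaussian {d : ℕ} {S : Matrix (Fin d) (Fin d) ℝ}
    (hS : S.PosSemidef) (μ θ : EuclideanSpace ℝ (Fin d)) :
    (multivariateGaussian μ S).map (fun w => inner ℝ θ w) =
      gaussianReal (inner ℝ θ μ) (quadForm S θ).toNNReal := by
  have h := IsGaussian.map_eq_gaussianReal (μ := multivariateGaussian μ S) (innerSL ℝ θ)
  have hm : ∫ w, innerSL ℝ θ w ∂(multivariateGaussian μ S) = inner ℝ θ μ := by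
    rw [ContinuousLinearMap.integral_comp_id_comm IsGaussian.integrable_id,
      integral_id_multivariateGaussian]
    rfl
  have hv : Var[innerSL ℝ θ; multivariateGaussian μ S] = quadForm S θ := by
    rw [quadForm_eq, ← covarianceBilin_multivariateGaussian (μ := μ) hS,
      covarianceBilin_self IsGaussian.memLp_two_id]
    rfl
  rw [hm, hv] at h
  exact h

theorem integral_exp_neg_mul_inner_sq_multivariateGaussian_le {d : ℕ}
    {S : Matrix (Fin d) (Fin d) ℝ} (hS : S.PosSemidef) (θ : EuclideanSpace ℝ (Fin d)) {l : ℝ}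
    (hl : 0 ≤ l) :
    ∫ w, Real.exp (-(l * inner ℝ θ w ^ 2)) ∂(multivariateGaussian 0 S) ≤
      Real.exp (-(l * quadForm S θ - l ^ 2 * quadForm S θ ^ 2)) := by
  have h := integral_exp_neg_mul_sq_gaussianReal_le (quadForm S θ).toNNReal hl
  have h2 := map_inner_multivariateGaussian hS 0 θ
  rw [inner_zero_right] at h2
  rw [← h2, integral_map (by fun_prop) (Continuous.aestronglyMeasurable (by fun_prop)),
    Real.coe_toNNReal _ (quadForm_nonneg hS θ)] at h
  exact h

/-- The normalized sum of independent centered Gaussian vectors has the law of each of them. -/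
theorem map_normalized_sum_pi_multivariateGaussian {d n : ℕ} (hn : n ≠ 0)
    {S : Matrix (Fin d) (Fin d) ℝ} (hS : S.PosSemidef) :
    (Measure.pi fun _ : Fin n => multivariateGaussian 0 S).map
      (fun w => (√(n : ℝ))⁻¹ • ∑ i, w i) = multivariateGaussian 0 S := by
  have hprob : IsProbabilityMeasure ((Measure.pi fun _ : Fin n => multivariateGaussian 0 S).map
      (fun w => (√(n : ℝ))⁻¹ • ∑ i, w i)) :=
    Measure.isProbabilityMeasure_map (Measurable.aemeasurable (by fun_prop))
  apply Measure.ext_of_charFun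
  ext t
  rw [charFun_apply, integral_map (Measurable.aemeasurable (by fun_prop))
    (Continuous.aestronglyMeasurable (by fun_prop))]
  have h1 : ∀ w : Fin n → EuclideanSpace ℝ (Fin d),
      Complex.exp ((inner ℝ ((√(n : ℝ))⁻¹ • ∑ i, w i) t : ℝ) * Complex.I) =
      ∏ i, Complex.exp ((inner ℝ (w i) ((√(n : ℝ))⁻¹ • t) : ℝ) * Complex.I) := by
    intro w
    rw [← Complex.exp_sum, ← Finset.sum_mul, ← Complex.ofReal_sum, ← sum_inner,
      real_inner_smul_left, real_inner_smul_right]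
  simp_rw [h1]
  rw [integral_fintype_prod_eq_prod (f := fun _ (x : EuclideanSpace ℝ (Fin d)) =>
    Complex.exp ((inner ℝ x ((√(n : ℝ))⁻¹ • t) : ℝ) * Complex.I))]
  simp_rw [← charFun_apply, charFun_multivariateGaussian hS, ← quadForm_eq]
  rw [Finset.prod_const, ← Complex.exp_nat_mul, quadForm_smul, inv_pow,
    Real.sq_sqrt (Nat.cast_nonneg n)]
  congr 1
  have : (n : ℂ) ≠ 0 := Nat.cast_ne_zero.2 hn
  simp only [inner_zero_right, Complex.ofReal_zero, zero_mul, zero_sub]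
  push_cast
  rw [Finset.card_fin]
  field_simp

/-! ### Deviation inequalities -/

/-- The upper tail of a sub-gamma random variable. -/
theorem measureReal_gt_le_of_subgamma {α : Type*} [MeasurableSpace α] (μ : Measure α)
    [IsProbabilityMeasure μ] (Z : α → ℝ) {m V σ t : ℝ} (hV : 0 < V) (hσ : 0 ≤ σ) (ht : 0 < t)
    (h : ∀ s, 0 ≤ s → 2 * s * σ < 1 → Integrable (fun a => Real.exp (s * Z a)) μ ∧
      ∫ a, Real.exp (s * Z a) ∂μ ≤ Real.exp (s * m + s ^ 2 * V / (1 - 2 * s * σ))) :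
    μ.real {a | m + 2 * √(V * t) + 2 * σ * t < Z a} ≤ Real.exp (-t) := by
  set r := √(V * t) with hr
  have hr0 : 0 < r := Real.sqrt_pos.2 (mul_pos hV ht)
  have hrr : r * r = V * t := Real.mul_self_sqrt (mul_pos hV ht).le
  have hD : 0 < 2 * σ + r / t := by positivity
  -- The Chernoff parameter `(2σ + r/t)⁻¹` makes the final exponent exactly `-t`.
  have hs1 : 1 - 2 * (2 * σ + r / t)⁻¹ * σ = (r / t) * (2 * σ + r / t)⁻¹ := by
    field_simp
    ring
  obtain ⟨hi, hle⟩ := h (2 * σ + r / t)⁻¹ (inv_nonneg.2 hD.le) (by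
    have : 0 < (r / t) * (2 * σ + r / t)⁻¹ := by positivity
    linarith)
  have h1 := measure_ge_le_exp_mul_mgf (μ := μ) (X := Z) (m + 2 * r + 2 * σ * t)
    (inv_nonneg.2 hD.le) hi
  refine le_trans (measureReal_mono (s₂ := {a | m + 2 * r + 2 * σ * t ≤ Z a})
    (Set.ofPred_subset_ofPred.2 fun _ => le_of_lt)) (h1.trans ?_)
  refine (mul_le_mul_of_nonneg_left hle (Real.exp_pos _).le).trans ?_
  rw [← Real.exp_add]
  refine Real.exp_le_exp.2 (le_of_eq ?_)
  rw [hs1]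
  have hVr : V = r * r / t := by field_simp; linarith
  rw [hVr]
  field_simp
  ring

theorem measureReal_norm_sq_gt_le {d : ℕ} {S : Matrix (Fin d) (Fin d) ℝ} (hS : S.PosSemidef)
    (h0 : S ≠ 0) {t : ℝ} (ht : 0 < t) :
    (multivariateGaussian 0 S).real
      {w | S.trace + 2 * √((S ^ 2).trace * t) + 2 * spectralNorm S * t < ‖w‖ ^ 2} ≤
      Real.exp (-t) :=
  measureReal_gt_le_of_subgamma _ _ (trace_sq_pos hS h0) (spectralNorm_nonneg S) ht
    fun _ hs0 hs => integrable_exp_norm_sq_multivariateGaussian hS hs0 hs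

theorem measureReal_sum_norm_sq_gt_le {d n : ℕ} (hn : n ≠ 0) {S : Matrix (Fin d) (Fin d) ℝ}
    (hS : S.PosSemidef) (h0 : S ≠ 0) {t : ℝ} (ht : 0 < t) :
    (Measure.pi fun _ : Fin n => multivariateGaussian 0 S).real
      {w | n * S.trace + 2 * √(n * (S ^ 2).trace * t) + 2 * spectralNorm S * t <
        ∑ i, ‖w i‖ ^ 2} ≤ Real.exp (-t) := by
  have hn' : (0 : ℝ) < n := Nat.cast_pos.2 (Nat.pos_of_ne_zero hn)
  refine measureReal_gt_le_of_subgamma _ _ (mul_pos hn' (trace_sq_pos hS h0))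
    (spectralNorm_nonneg S) ht fun s hs0 hs => ?_
  obtain ⟨hi, hle⟩ := integrable_exp_norm_sq_multivariateGaussian hS hs0 hs
  simp_rw [Finset.mul_sum, Real.exp_sum]
  refine ⟨Integrable.fintype_prod (f := fun _ w => Real.exp (s * ‖w‖ ^ 2)) fun _ => hi, ?_⟩
  rw [integral_fintype_prod_eq_pow (fun w : EuclideanSpace ℝ (Fin d) => Real.exp (s * ‖w‖ ^ 2)),
    Fintype.card_fin]
  refine (pow_le_pow_left₀ (integral_nonneg fun w => (Real.exp_pos _).le) hle n).trans
    (le_of_eq ?_)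
  rw [← Real.exp_nat_mul]
  congr 1
  ring

theorem measureReal_inner_gt_le {d : ℕ} {S : Matrix (Fin d) (Fin d) ℝ} (hS : S.PosSemidef)
    (h0 : S ≠ 0) (v : EuclideanSpace ℝ (Fin d)) {t : ℝ} (ht : 0 < t) :
    (multivariateGaussian 0 S).real {w | ‖v‖ * √(2 * spectralNorm S * t) < inner ℝ v w} ≤
      Real.exp (-t) := by
  by_cases hv : v = 0
  · simp [hv, Real.exp_nonneg]
  have hv0 : 0 < ‖v‖ := norm_pos_iff.2 hv
  have hσ := spectralNorm_pos h0
  set r := √(2 * spectralNorm S * t) with hr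
  have hr0 : 0 < r := Real.sqrt_pos.2 (by positivity)
  have hrr : r * r = 2 * spectralNorm S * t := Real.mul_self_sqrt (by positivity)
  have hmap := map_inner_multivariateGaussian hS 0 v
  rw [inner_zero_right] at hmap
  -- Optimal Chernoff parameter when the variance is replaced by its upper bound `‖S‖ ‖v‖²`.
  set s := r / (spectralNorm S * ‖v‖) with hs
  have hs0 : 0 ≤ s := by positivity
  have hi : Integrable (fun w => Real.exp (s * inner ℝ v w)) (multivariateGaussian 0 S) := by
    have := integrable_exp_mul_gaussianReal (μ := 0) (v := (quadForm S v).toNNReal) s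
    rw [← hmap] at this
    exact this.comp_measurable (by fun_prop)
  have h1 := measure_ge_le_exp_mul_mgf (μ := multivariateGaussian 0 S)
    (X := fun w => inner ℝ v w) (‖v‖ * r) hs0 hi
  refine le_trans (measureReal_mono (s₂ := {w | ‖v‖ * r ≤ inner ℝ v w})
    (Set.ofPred_subset_ofPred.2 fun _ => le_of_lt)) (h1.trans ?_)
  rw [mgf_gaussianReal hmap, ← Real.exp_add, Real.coe_toNNReal _ (quadForm_nonneg hS v)]
  refine Real.exp_le_exp.2 ?_
  have h2 : quadForm S v * s ^ 2 / 2 ≤ spectralNorm S * ‖v‖ ^ 2 * s ^ 2 / 2 := by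
    gcongr
    exact quadForm_le S v
  have h3 : spectralNorm S * ‖v‖ ^ 2 * s ^ 2 / 2 = t := by
    rw [hs]
    field_simp
    nlinarith
  have h4 : s * (‖v‖ * r) = 2 * t := by
    rw [hs]
    field_simp
    nlinarith
  linarith

/-- The exponent of the variational argument for the lower tail of the empirical covariance. -/
noncomputable def lowerTailExponent {d n : ℕ} (S : Matrix (Fin d) (Fin d) ℝ) (l : ℝ)
    (w : Fin n → EuclideanSpace ℝ (Fin d)) (θ : EuclideanSpace ℝ (Fin d)) : ℝ :=
  n * (l * quadForm S θ - l ^ 2 * quadForm S θ ^ 2) - l * ∑ i, inner ℝ (w i) θ ^ 2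

theorem continuous_lowerTailExponent {d n : ℕ} (S : Matrix (Fin d) (Fin d) ℝ) (l : ℝ) :
    Continuous fun x : (Fin n → EuclideanSpace ℝ (Fin d)) × EuclideanSpace ℝ (Fin d) =>
      lowerTailExponent S l x.1 x.2 := by
  have := continuous_quadForm S
  unfold lowerTailExponent
  fun_prop

/-- As `x - x² ≤ 1`, the exponent is bounded above; this justifies Fubini's theorem and Jensen's
inequality without further moment conditions. -/
theorem lowerTailExponent_le {d n : ℕ} (S : Matrix (Fin d) (Fin d) ℝ) {l : ℝ} (hl : 0 ≤ l)
    (w : Fin n → EuclideanSpace ℝ (Fin d)) (θ : EuclideanSpace ℝ (Fin d)) :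
    lowerTailExponent S l w θ ≤ n := by
  unfold lowerTailExponent
  have h1 : 0 ≤ l * ∑ i, inner ℝ (w i) θ ^ 2 :=
    mul_nonneg hl (Finset.sum_nonneg fun i _ => sq_nonneg _)
  have h2 : l * quadForm S θ - l ^ 2 * quadForm S θ ^ 2 ≤ 1 := by
    nlinarith [sq_nonneg (l * quadForm S θ - 1 / 2)]
  have h3 := mul_le_mul_of_nonneg_left h2 (Nat.cast_nonneg (α := ℝ) n)
  linarith

theorem integrable_exp_lowerTailExponent {d n : ℕ} {S : Matrix (Fin d) (Fin d) ℝ} {l : ℝ}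
    (hl : 0 ≤ l) :
    Integrable (fun x : (Fin n → EuclideanSpace ℝ (Fin d)) × EuclideanSpace ℝ (Fin d) =>
      Real.exp (lowerTailExponent S l x.1 x.2))
      ((Measure.pi fun _ : Fin n => multivariateGaussian 0 S).prod
        (stdGaussian (EuclideanSpace ℝ (Fin d)))) := by
  refine Integrable.of_bound
    (Real.continuous_exp.comp (continuous_lowerTailExponent S l)).aestronglyMeasurable
    (Real.exp n) (Filter.Eventually.of_forall fun x => ?_)
  rw [Real.norm_of_nonneg (Real.exp_pos _).le]
  exact Real.exp_le_exp.2 (lowerTailExponent_le S hl _ _)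

/-- After Fubini, independence factors the integral at fixed `θ`; each factor is at most 1, because
the term `l² q²` absorbs the second-order error of the Laplace transform. -/
theorem integral_exp_lowerTailExponent_le {d n : ℕ} {S : Matrix (Fin d) (Fin d) ℝ}
    (hS : S.PosSemidef) {l : ℝ} (hl : 0 ≤ l) :
    ∫ w, ∫ θ, Real.exp (lowerTailExponent S l w θ) ∂(stdGaussian (EuclideanSpace ℝ (Fin d)))
      ∂(Measure.pi fun _ : Fin n => multivariateGaussian 0 S) ≤ 1 := by
  rw [integral_integral_swap (integrable_exp_lowerTailExponent hl)]
  have h1 : ∀ θ : EuclideanSpace ℝ (Fin d),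
      ∫ w, Real.exp (lowerTailExponent S l w θ)
        ∂(Measure.pi fun _ : Fin n => multivariateGaussian 0 S) ≤ 1 := by
    intro θ
    have h2 : ∀ w : Fin n → EuclideanSpace ℝ (Fin d), Real.exp (lowerTailExponent S l w θ) =
        Real.exp (l * quadForm S θ - l ^ 2 * quadForm S θ ^ 2) ^ n *
          ∏ i, Real.exp (-(l * inner ℝ θ (w i) ^ 2)) := by
      intro w
      have h3 : ∑ i, inner ℝ θ (w i) ^ 2 = ∑ i, inner ℝ (w i) θ ^ 2 :=
        Finset.sum_congr rfl fun i _ => by rw [real_inner_comm]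
      rw [← Real.exp_nat_mul, ← Real.exp_sum, ← Real.exp_add, Finset.sum_neg_distrib,
        ← Finset.mul_sum, ← sub_eq_add_neg, h3]
      rfl
    simp_rw [h2]
    rw [integral_const_mul, integral_fintype_prod_eq_pow
      (fun w : EuclideanSpace ℝ (Fin d) => Real.exp (-(l * inner ℝ θ w ^ 2))), Fintype.card_fin,
      ← mul_pow]
    refine pow_le_one₀ (mul_nonneg (Real.exp_pos _).le
      (integral_nonneg fun w => (Real.exp_pos _).le)) ?_
    refine (mul_le_mul_of_nonneg_left
      (integral_exp_neg_mul_inner_sq_multivariateGaussian_le hS θ hl) (Real.exp_pos _).le).trans ?_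
    rw [← Real.exp_add, add_neg_cancel, Real.exp_zero]
  refine (integral_mono (integrable_exp_lowerTailExponent hl).integral_prod_right
    (integrable_const 1) h1).trans ?_
  simp

/-- The cross term is centred; `‖w‖²` is the noise introduced by smoothing. -/
theorem integral_inner_add_sq_stdGaussian {d : ℕ} (w a : EuclideanSpace ℝ (Fin d)) :
    Integrable (fun θ => inner ℝ w (θ + a) ^ 2) (stdGaussian (EuclideanSpace ℝ (Fin d))) ∧
    ∫ θ, inner ℝ w (θ + a) ^ 2 ∂(stdGaussian (EuclideanSpace ℝ (Fin d))) =
      inner ℝ w a ^ 2 + ‖w‖ ^ 2 := by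
  have h0 : ∫ θ, inner ℝ w θ ∂(stdGaussian (EuclideanSpace ℝ (Fin d))) = 0 :=
    integral_strongDual_stdGaussian (innerSL ℝ w)
  have hv : ∫ θ, inner ℝ w θ ^ 2 ∂(stdGaussian (EuclideanSpace ℝ (Fin d))) = ‖w‖ ^ 2 := by
    have h1 := variance_dual_stdGaussian (innerSL ℝ w)
    rw [variance_of_integral_eq_zero (X := innerSL ℝ w) (by fun_prop) h0,
      innerSL_apply_norm] at h1
    exact h1
  have hL : Integrable (fun θ : EuclideanSpace ℝ (Fin d) => inner ℝ w θ)
      (stdGaussian (EuclideanSpace ℝ (Fin d))) := IsGaussian.integrable_id.const_inner w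
  have hQ : Integrable (fun θ : EuclideanSpace ℝ (Fin d) => inner ℝ w θ ^ 2)
      (stdGaussian (EuclideanSpace ℝ (Fin d))) :=
    (IsGaussian.memLp_two_id.const_inner w).integrable_sq
  have he : ∀ θ, inner ℝ w (θ + a) ^ 2 =
      inner ℝ w θ ^ 2 + 2 * inner ℝ w a * inner ℝ w θ + inner ℝ w a ^ 2 := by
    intro θ
    rw [inner_add_right]
    ring
  simp_rw [he]
  have hQL : Integrable (fun θ => inner ℝ w θ ^ 2 + 2 * inner ℝ w a * inner ℝ w θ)
      (stdGaussian (EuclideanSpace ℝ (Fin d))) := hQ.add (hL.const_mul _)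
  refine ⟨hQL.add (integrable_const _), ?_⟩
  rw [integral_add hQL (integrable_const _),
    integral_add hQ (hL.const_mul _), integral_const_mul, h0, hv]
  simp
  ring

theorem integral_quadForm_add_stdGaussian {d : ℕ} {S : Matrix (Fin d) (Fin d) ℝ}
    (hS : S.PosSemidef) (a : EuclideanSpace ℝ (Fin d)) :
    Integrable (fun θ => quadForm S (θ + a)) (stdGaussian (EuclideanSpace ℝ (Fin d))) ∧
    ∫ θ, quadForm S (θ + a) ∂(stdGaussian (EuclideanSpace ℝ (Fin d))) =
      quadForm S a + S.trace := by
  set A := Matrix.toEuclideanCLM (n := Fin d) (𝕜 := ℝ) S with hA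
  have h0 : ∀ w : EuclideanSpace ℝ (Fin d),
      ∫ θ, inner ℝ w θ ∂(stdGaussian (EuclideanSpace ℝ (Fin d))) = 0 :=
    fun w => integral_strongDual_stdGaussian (innerSL ℝ w)
  have hL : ∀ w : EuclideanSpace ℝ (Fin d),
      Integrable (fun θ : EuclideanSpace ℝ (Fin d) => inner ℝ w θ)
        (stdGaussian (EuclideanSpace ℝ (Fin d))) :=
    fun w => IsGaussian.integrable_id.const_inner w
  have hQ := integrable_quadForm_stdGaussian hS
  have he : ∀ θ, quadForm S (θ + a) =
      quadForm S θ + inner ℝ (A a + A.adjoint a) θ + quadForm S a := by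
    intro θ
    unfold quadForm
    rw [← hA, map_add, inner_add_left, inner_add_right, inner_add_right, inner_add_left,
      ContinuousLinearMap.adjoint_inner_left, real_inner_comm θ]
    ring
  simp_rw [he]
  have hQL : Integrable (fun θ => quadForm S θ + inner ℝ (A a + A.adjoint a) θ)
      (stdGaussian (EuclideanSpace ℝ (Fin d))) := hQ.add (hL _)
  refine ⟨hQL.add (integrable_const _), ?_⟩
  rw [integral_add hQL (integrable_const _), integral_add hQ (hL _), h0,
    integral_quadForm_stdGaussian hS]
  simp
  ring

theorem integral_quadForm_add_sq_stdGaussian_le {d : ℕ} {S : Matrix (Fin d) (Fin d) ℝ}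
    (hS : S.PosSemidef) (a : EuclideanSpace ℝ (Fin d)) :
    Integrable (fun θ => quadForm S (θ + a) ^ 2) (stdGaussian (EuclideanSpace ℝ (Fin d))) ∧
    ∫ θ, quadForm S (θ + a) ^ 2 ∂(stdGaussian (EuclideanSpace ℝ (Fin d))) ≤
      8 * (spectralNorm S * ‖a‖ ^ 2) ^ 2 + 72 * S.trace ^ 2 := by
  have hb : ∀ θ, quadForm S (θ + a) ^ 2 ≤
      8 * quadForm S θ ^ 2 + 8 * (spectralNorm S * ‖a‖ ^ 2) ^ 2 := by
    intro θ
    have h1 := quadForm_add_add_quadForm_sub S θ a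
    have h2 := quadForm_nonneg hS (θ - a)
    have h3 := quadForm_nonneg hS (θ + a)
    -- Parallelogram identity, dropping the nonnegative value at `θ - a`.
    have h4 : quadForm S (θ + a) ≤ 2 * (quadForm S θ + spectralNorm S * ‖a‖ ^ 2) := by
      linarith [quadForm_le S a]
    nlinarith [pow_le_pow_left₀ h3 h4 2, sq_nonneg (quadForm S θ - spectralNorm S * ‖a‖ ^ 2)]
  have hi : Integrable (fun θ => 8 * quadForm S θ ^ 2 + 8 * (spectralNorm S * ‖a‖ ^ 2) ^ 2)
      (stdGaussian (EuclideanSpace ℝ (Fin d))) :=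
    ((integrable_quadForm_sq_stdGaussian hS).const_mul _).add (integrable_const _)
  have hi' : Integrable (fun θ => quadForm S (θ + a) ^ 2)
      (stdGaussian (EuclideanSpace ℝ (Fin d))) := by
    have := continuous_quadForm S
    refine hi.mono' (Continuous.aestronglyMeasurable (by fun_prop))
      (Filter.Eventually.of_forall fun θ => ?_)
    rw [Real.norm_of_nonneg (sq_nonneg _)]
    exact hb θ
  refine ⟨hi', (integral_mono hi' hi hb).trans ?_⟩
  rw [integral_add ((integrable_quadForm_sq_stdGaussian hS).const_mul _) (integrable_const _),
    integral_const_mul]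
  simp
  linarith [integral_quadForm_sq_stdGaussian_le hS]

/-- A lower bound for Gaussian averages of the exponent over a translate. -/
theorem le_integral_lowerTailExponent {d n : ℕ} {S : Matrix (Fin d) (Fin d) ℝ}
    (hS : S.PosSemidef) {l : ℝ} (w : Fin n → EuclideanSpace ℝ (Fin d))
    (a : EuclideanSpace ℝ (Fin d)) :
    Integrable (fun θ => lowerTailExponent S l w (θ + a))
      (stdGaussian (EuclideanSpace ℝ (Fin d))) ∧
    n * (l * (quadForm S a + S.trace)
        - l ^ 2 * (8 * (spectralNorm S * ‖a‖ ^ 2) ^ 2 + 72 * S.trace ^ 2))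
      - l * (∑ i, inner ℝ (w i) a ^ 2 + ∑ i, ‖w i‖ ^ 2) ≤
    ∫ θ, lowerTailExponent S l w (θ + a) ∂(stdGaussian (EuclideanSpace ℝ (Fin d))) := by
  obtain ⟨hq, hqe⟩ := integral_quadForm_add_stdGaussian hS a
  obtain ⟨hq2, hq2e⟩ := integral_quadForm_add_sq_stdGaussian_le hS a
  have hs : Integrable (fun θ => ∑ i, inner ℝ (w i) (θ + a) ^ 2)
      (stdGaussian (EuclideanSpace ℝ (Fin d))) :=
    integrable_finsetSum _ fun i _ => (integral_inner_add_sq_stdGaussian (w i) a).1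
  have hse : ∫ θ, ∑ i, inner ℝ (w i) (θ + a) ^ 2 ∂(stdGaussian (EuclideanSpace ℝ (Fin d))) =
      ∑ i, inner ℝ (w i) a ^ 2 + ∑ i, ‖w i‖ ^ 2 := by
    rw [integral_finsetSum _ fun i _ => (integral_inner_add_sq_stdGaussian (w i) a).1,
      ← Finset.sum_add_distrib]
    exact Finset.sum_congr rfl fun i _ => (integral_inner_add_sq_stdGaussian (w i) a).2
  have h1 : Integrable (fun θ => n * (l * quadForm S (θ + a) - l ^ 2 * quadForm S (θ + a) ^ 2))
      (stdGaussian (EuclideanSpace ℝ (Fin d))) :=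
    ((hq.const_mul l).sub (hq2.const_mul (l ^ 2))).const_mul (n : ℝ)
  refine ⟨h1.sub (hs.const_mul l), ?_⟩
  unfold lowerTailExponent
  rw [integral_sub h1 (hs.const_mul l), integral_const_mul, integral_const_mul,
    integral_sub (hq.const_mul l) (hq2.const_mul (l ^ 2)), integral_const_mul,
    integral_const_mul, hqe, hse]
  gcongr

/-- The lower tail of the empirical covariance of Gaussian vectors, uniformly over directions. -/
theorem measureReal_not_lowerTail_le {d n : ℕ} {S : Matrix (Fin d) (Fin d) ℝ}
    (hS : S.PosSemidef) {l : ℝ} (hl : 0 ≤ l) (t : ℝ) :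
    (Measure.pi fun _ : Fin n => multivariateGaussian 0 S).real
      {w | ¬ ∀ a, n * (l * (quadForm S a + S.trace)
        - l ^ 2 * (8 * (spectralNorm S * ‖a‖ ^ 2) ^ 2 + 72 * S.trace ^ 2))
      - l * (∑ i, inner ℝ (w i) a ^ 2 + ∑ i, ‖w i‖ ^ 2) - ‖a‖ ^ 2 / 2 ≤ t} ≤
      Real.exp (-t) := by
  -- Markov's inequality for the average over `θ`. The uncountable union over `a` lies inside this
  -- single event, so no net is needed.
  have h1 := mul_meas_ge_le_integral_of_nonneg (Filter.Eventually.of_forall fun w =>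
    integral_nonneg fun θ => (Real.exp_pos _).le)
    (integrable_exp_lowerTailExponent (n := n) (S := S) hl).integral_prod_left (Real.exp t)
  have h2 := h1.trans (integral_exp_lowerTailExponent_le hS hl)
  rw [← le_div_iff₀' (Real.exp_pos t), one_div, ← Real.exp_neg] at h2
  refine le_trans (measureReal_mono ?_) h2
  intro w hw
  rw [Set.mem_ofPred_eq, not_forall] at hw
  obtain ⟨a, ha⟩ := hw
  rw [not_le] at ha
  obtain ⟨hi, hle⟩ := le_integral_lowerTailExponent hS (l := l) w a
  have h3 := exp_integral_shift_le a
    ((continuous_lowerTailExponent S l).comp (Continuous.prodMk_right w))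
    (lowerTailExponent_le S hl w) hi
  refine le_trans (Real.exp_le_exp.2 ?_) h3
  dsimp only [Function.comp_apply]
  linarith

/-! ### Traces of square roots -/

theorem trace_mul_nonneg {d : ℕ} {A B : Matrix (Fin d) (Fin d) ℝ} (hA : A.PosSemidef)
    (hB : B.PosSemidef) : 0 ≤ (A * B).trace := by
  have hC : (CFC.sqrt B).PosSemidef := Matrix.nonneg_iff_posSemidef.1 (CFC.sqrt_nonneg B)
  have h := (hA.mul_mul_conjTranspose_same (CFC.sqrt B)).trace_nonneg
  rwa [hC.isHermitian.eq, Matrix.mul_assoc, Matrix.trace_mul_comm, Matrix.mul_assoc,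
    CFC.sqrt_mul_sqrt_self B hB.nonneg] at h

/-- Expand `Tr (C - Y) Y⁻¹ (C - Y) ≥ 0`. For `C = M^{1/2}` the right side is linear in `M`, so it
can be compared with other matrices. -/
theorem two_mul_trace_le {d : ℕ} {C Y : Matrix (Fin d) (Fin d) ℝ} (hC : C.IsHermitian)
    (hY : Y.PosDef) : 2 * C.trace ≤ (C * C * Y⁻¹).trace + Y.trace := by
  have hdet : IsUnit Y.det := (Matrix.isUnit_iff_isUnit_det Y).1 hY.isUnit
  have h := (hY.inv.posSemidef.mul_mul_conjTranspose_same (C - Y)).trace_nonneg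
  have he : (C - Y) * Y⁻¹ * (C - Y)ᴴ = C * Y⁻¹ * C - C - C + Y := by
    rw [(hC.sub hY.isHermitian).eq, Matrix.sub_mul, Matrix.mul_nonsing_inv Y hdet, Matrix.sub_mul,
      Matrix.one_mul, Matrix.mul_sub, Matrix.mul_assoc C Y⁻¹ Y, Matrix.nonsing_inv_mul Y hdet,
      Matrix.mul_one]
    abel
  rw [he, Matrix.trace_add, Matrix.trace_sub, Matrix.trace_sub, Matrix.trace_mul_comm,
    ← Matrix.mul_assoc] at h
  linarith

/-- `A - A (A + E)⁻¹ A` is positive semidefinite, being a sum of a congruence of `A` and a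
congruence of `E`. -/
theorem trace_mul_self_mul_inv_le {d : ℕ} {A E : Matrix (Fin d) (Fin d) ℝ} (hA : A.PosSemidef)
    (hE : E.PosSemidef) (hY : (A + E).PosDef) : (A * A * (A + E)⁻¹).trace ≤ A.trace := by
  have hdet : IsUnit (A + E).det := (Matrix.isUnit_iff_isUnit_det _).1 hY.isUnit
  set Y := A + E with hYdef
  have hYi : Y⁻¹ᴴ = Y⁻¹ := hY.inv.isHermitian.eq
  have hE' : E = Y - A := by rw [hYdef]; abel
  have h1 := (hA.conjTranspose_mul_mul_same (1 - Y⁻¹ * A)).trace_nonneg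
  have h2 := (hE.conjTranspose_mul_mul_same (Y⁻¹ * A)).trace_nonneg
  have he : (1 - Y⁻¹ * A)ᴴ * A * (1 - Y⁻¹ * A) + (Y⁻¹ * A)ᴴ * E * (Y⁻¹ * A) =
      A - A * Y⁻¹ * A := by
    have hYY : Y * (Y⁻¹ * A) = A := by
      rw [← Matrix.mul_assoc, Matrix.mul_nonsing_inv Y hdet, Matrix.one_mul]
    rw [Matrix.conjTranspose_sub, Matrix.conjTranspose_one, Matrix.conjTranspose_mul, hYi,
      hA.isHermitian.eq, hE']
    simp only [Matrix.sub_mul, Matrix.mul_sub, Matrix.one_mul, Matrix.mul_one, Matrix.mul_assoc,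
      hYY]
    abel
  have h3 : (A * A * Y⁻¹).trace = (A * Y⁻¹ * A).trace := by
    rw [Matrix.trace_mul_comm (A * Y⁻¹) A, Matrix.mul_assoc]
  have h4 := congrArg Matrix.trace he
  rw [Matrix.trace_add, Matrix.trace_sub] at h4
  linarith

/-- The trace of the square root is monotone, with a square-root modulus of continuity. -/
theorem trace_sqrt_le {d : ℕ} {M N B : Matrix (Fin d) (Fin d) ℝ} (hM : M.PosSemidef)
    (hN : N.PosSemidef) (hB : B.PosDef) {ε : ℝ} (hε : 0 < ε)
    (h : (N + ε • (B * B) - M).PosSemidef) :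
    (CFC.sqrt M).trace ≤ (CFC.sqrt N).trace + √ε * B.trace := by
  have hsM : (CFC.sqrt M).PosSemidef := Matrix.nonneg_iff_posSemidef.1 (CFC.sqrt_nonneg M)
  have hsN : (CFC.sqrt N).PosSemidef := Matrix.nonneg_iff_posSemidef.1 (CFC.sqrt_nonneg N)
  have hE : (√ε • B).PosDef := hB.smul (Real.sqrt_pos.2 hε)
  -- This sum is the test matrix `Y` of the variational inequality. It dominates both summands, so
  -- `Tr (N Y⁻¹)` and `Tr (ε B² Y⁻¹)` are bounded by their traces.
  have hY : (CFC.sqrt N + √ε • B).PosDef := Matrix.PosDef.posSemidef_add hsN hE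
  have h1 := two_mul_trace_le hsM.isHermitian hY
  have h2 := trace_mul_nonneg h hY.inv.posSemidef
  have h3 := trace_mul_self_mul_inv_le hsN hE.posSemidef hY
  have h4 := trace_mul_self_mul_inv_le hE.posSemidef hsN (by rwa [add_comm])
  have hEE : (√ε • B) * (√ε • B) = ε • (B * B) := by
    rw [Matrix.smul_mul, Matrix.mul_smul, smul_smul, Real.mul_self_sqrt hε.le]
  rw [CFC.sqrt_mul_sqrt_self M hM.nonneg] at h1
  rw [CFC.sqrt_mul_sqrt_self N hN.nonneg] at h3
  rw [hEE, add_comm] at h4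
  rw [Matrix.sub_mul, Matrix.add_mul, Matrix.trace_sub, Matrix.trace_add] at h2
  rw [Matrix.trace_add] at h1
  rw [Matrix.trace_smul, smul_eq_mul] at h1 h4
  linarith

/-- The trace of the principal square root in the Fréchet distance. -/
theorem trace_principalSqrt_mul {d : ℕ} {S T : Matrix (Fin d) (Fin d) ℝ}
    (hS : S.PosSemidef) (hT : T.PosDef) :
    (principalSqrt (S * T)).trace =
      (CFC.sqrt (CFC.sqrt T * S * CFC.sqrt T)).trace := by
  have hB : (CFC.sqrt T).det ≠ 0 := by
    intro h0
    have h1 := congrArg Matrix.det (CFC.sqrt_mul_sqrt_self T hT.posSemidef.nonneg)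
    rw [Matrix.det_mul, h0, zero_mul] at h1
    exact hT.det_pos.ne h1
  rw [principalSqrt_eq (isPrincipalSqrt_mul hS hT), Matrix.trace_mul_comm, ← Matrix.mul_assoc,
    Matrix.mul_nonsing_inv _ (isUnit_iff_ne_zero.2 hB), Matrix.one_mul]

/-- If `S ≤ S' + ε` as quadratic forms, then `Tr (S T)^{1/2} ≤ Tr (S' T)^{1/2} + ε^{1/2} Tr T^{1/2}`.
-/
theorem trace_principalSqrt_mul_le {d : ℕ} {S S' T : Matrix (Fin d) (Fin d) ℝ}
    (hS : S.PosSemidef) (hS' : S'.PosSemidef) (hT : T.PosDef) {ε : ℝ} (hε : 0 < ε)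
    (h : ∀ u, quadForm S u ≤ quadForm S' u + ε * ‖u‖ ^ 2) :
    (principalSqrt (S * T)).trace ≤
      (principalSqrt (S' * T)).trace + √ε * (CFC.sqrt T).trace := by
  have hB : (CFC.sqrt T).PosSemidef := Matrix.nonneg_iff_posSemidef.1 (CFC.sqrt_nonneg T)
  have hBd : (CFC.sqrt T).PosDef := by
    rw [hB.posDef_iff_isUnit]
    exact isUnit_of_mul_isUnit_left
      ((CFC.sqrt_mul_sqrt_self T hT.posSemidef.nonneg).symm ▸ hT.isUnit)
  have hconj : ∀ {R : Matrix (Fin d) (Fin d) ℝ}, R.PosSemidef →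
      (CFC.sqrt T * R * CFC.sqrt T).PosSemidef := fun {R} hR => by
    have := hR.mul_mul_conjTranspose_same (CFC.sqrt T)
    rwa [hB.isHermitian.eq] at this
  rw [trace_principalSqrt_mul hS hT, trace_principalSqrt_mul hS' hT]
  refine trace_sqrt_le (hconj hS) (hconj hS') hBd hε ?_
  have h1 : (S' + ε • 1 - S).PosSemidef := by
    refine Matrix.PosSemidef.of_dotProduct_mulVec_nonneg ?_ fun x => ?_
    · exact (hS'.isHermitian.add (Matrix.isHermitian_one.smul (IsSelfAdjoint.all ε))).sub
        hS.isHermitian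
    · have h2 := h (WithLp.toLp 2 x)
      rw [quadForm_eq, quadForm_eq, EuclideanSpace.real_norm_sq_eq] at h2
      simp only [star_trivial, Matrix.sub_mulVec, Matrix.add_mulVec, Matrix.smul_mulVec,
        Matrix.one_mulVec, dotProduct_sub, dotProduct_add, dotProduct_smul, smul_eq_mul]
      have h3 : x ⬝ᵥ x = ∑ i, x i ^ 2 := Finset.sum_congr rfl fun i _ => (sq (x i)).symm
      rw [h3]
      linarith
  have h2 := hconj h1
  rw [Matrix.mul_sub, Matrix.mul_add, Matrix.sub_mul, Matrix.add_mul, Matrix.mul_smul,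
    Matrix.mul_one, Matrix.smul_mul] at h2
  exact h2

/-! ### The sub-Gaussian constant of a Gaussian vector -/

/-- Because `1 + z ≤ exp z`, the condition `E exp (Z² / t²) ≤ 2` forces `t²` to be at least the
variance of `Z`; apply this in a direction of positive variance. -/
theorem one_le_of_subGaussianConst {d : ℕ} {α : Type*} [MeasurableSpace α] {p : Measure α}
    {f : α → EuclideanSpace ℝ (Fin d)} {μ : EuclideanSpace ℝ (Fin d)}
    {S : Matrix (Fin d) (Fin d) ℝ} (hS : S.PosSemidef) (h0 : S ≠ 0)
    (hf : HasLaw f (multivariateGaussian μ S) p) {κ : ℝ}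
    (hκ : SubGaussianConst p (fun a => f a - μ) S κ) : 1 ≤ κ := by
  obtain ⟨y, hy⟩ : ∃ y, 0 < quadForm S y := by
    by_contra! hc
    obtain ⟨b, l, hl, -, hb, -, hT, -⟩ := exists_eigenbasis hS
    refine h0 (hS.trace_eq_zero_iff.1 ?_)
    rw [hT]
    refine Finset.sum_eq_zero fun k _ => le_antisymm ?_ (hl k)
    have := hc (b k)
    rw [quadForm, hb, inner_smul_right, real_inner_self_eq_norm_sq, b.norm_eq_one] at this
    simpa using this
  have h1 := hκ y
  rw [← quadForm_eq] at h1
  have hq : 0 < √(quadForm S y) := Real.sqrt_pos.2 hy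
  have h2 : ENNReal.ofReal (√(quadForm S y)) ≤
      psiTwoNorm p (fun a => inner ℝ y (f a - μ)) := by
    refine le_iInf₂ fun t ht => ENNReal.ofReal_le_ofReal ?_
    obtain ⟨ht0, ht⟩ := ht
    have hlaw : HasLaw (fun a => inner ℝ y (f a) - inner ℝ y μ)
        (gaussianReal 0 (quadForm S y).toNNReal) p := by
      have h3 : HasLaw (fun w => inner ℝ y w) (gaussianReal (inner ℝ y μ)
          (quadForm S y).toNNReal) (multivariateGaussian μ S) :=
        ⟨by fun_prop, map_inner_multivariateGaussian hS μ y⟩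
      simpa using gaussianReal_sub_const (h3.comp hf) (inner ℝ y μ)
    have h4 : ∫⁻ x, ENNReal.ofReal (Real.exp (x ^ 2 / t ^ 2))
        ∂(gaussianReal 0 (quadForm S y).toNNReal) ≤ 2 := by
      rw [← hlaw.lintegral_comp (by fun_prop)]
      simpa only [inner_sub_right] using ht
    have h5 : ENNReal.ofReal (1 + quadForm S y / t ^ 2) ≤ 2 := by
      refine le_trans ?_ h4
      have hi : Integrable (fun x : ℝ => x ^ 2)
          (gaussianReal 0 (quadForm S y).toNNReal) := (memLp_id_gaussianReal 2).integrable_sq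
      have hvar : ∫ x, x ^ 2 ∂(gaussianReal 0 (quadForm S y).toNNReal) = quadForm S y := by
        have := variance_fun_id_gaussianReal (μ := 0) (v := (quadForm S y).toNNReal)
        rw [variance_of_integral_eq_zero (by fun_prop) integral_id_gaussianReal,
          Real.coe_toNNReal _ hy.le] at this
        exact this
      have hval : ∫ x, (1 + x ^ 2 / t ^ 2) ∂(gaussianReal 0 (quadForm S y).toNNReal) =
          1 + quadForm S y / t ^ 2 := by
        rw [integral_add (integrable_const _) (hi.div_const _), integral_div, hvar]
        simp
      have hi1 : Integrable (fun x : ℝ => 1 + x ^ 2 / t ^ 2)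
          (gaussianReal 0 (quadForm S y).toNNReal) := (integrable_const _).add (hi.div_const _)
      rw [← hval, ofReal_integral_eq_lintegral_ofReal hi1
        (Filter.Eventually.of_forall fun x => by positivity)]
      refine lintegral_mono fun x => ENNReal.ofReal_le_ofReal ?_
      linarith [Real.add_one_le_exp (x ^ 2 / t ^ 2)]
    have h6 : 1 + quadForm S y / t ^ 2 ≤ 2 := by
      rw [show (2 : ENNReal) = ENNReal.ofReal 2 by simp] at h5
      exact (ENNReal.ofReal_le_ofReal_iff (by norm_num)).1 h5
    have h7 : quadForm S y ≤ t ^ 2 := by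
      rw [← div_le_one (by positivity)]
      linarith
    exact Real.sqrt_le_iff.2 ⟨ht0.le, h7⟩
  have h3 := h2.trans h1
  rw [ENNReal.ofReal_le_ofReal_iff'] at h3
  rcases h3 with h3 | h3
  · exact le_of_mul_le_mul_right (by linarith) hq
  · linarith

/-! ### Sample mean and sample covariance -/

theorem sum_sub_eq_smul_sampleMean_sub {d n : ℕ} (hn : n ≠ 0)
    (y : Fin n → EuclideanSpace ℝ (Fin d)) (μ : EuclideanSpace ℝ (Fin d)) :
    ∑ i, (y i - μ) = (n : ℝ) • (sampleMean y - μ) := by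
  have hn' : (n : ℝ) ≠ 0 := Nat.cast_ne_zero.2 hn
  rw [Finset.sum_sub_distrib, Finset.sum_const, Finset.card_fin, smul_sub, sampleMean, smul_smul,
    mul_one_div_cancel hn', one_smul, Nat.cast_smul_eq_nsmul]

theorem posSemidef_sampleCov {d n : ℕ} (y : Fin n → EuclideanSpace ℝ (Fin d)) :
    (sampleCov y).PosSemidef := by
  refine Matrix.PosSemidef.smul (Matrix.posSemidef_sum _ fun i _ => ?_) (by positivity)
  simpa using Matrix.posSemidef_vecMulVec_self_star (y i - sampleMean y).ofLp

theorem average_sq_sub {n : ℕ} (hn : n ≠ 0) (c : Fin n → ℝ) {m : ℝ} (h : ∑ i, c i = n * m) :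
    1 / (n : ℝ) * ∑ i, (c i - m) ^ 2 = 1 / (n : ℝ) * ∑ i, c i ^ 2 - m ^ 2 := by
  have hn' : (n : ℝ) ≠ 0 := Nat.cast_ne_zero.2 hn
  simp_rw [sub_sq]
  rw [Finset.sum_add_distrib, Finset.sum_sub_distrib, ← Finset.sum_mul, ← Finset.mul_sum, h,
    Finset.sum_const, Finset.card_fin, nsmul_eq_mul]
  field_simp
  ring

theorem quadForm_sampleCov {d n : ℕ} (hn : n ≠ 0) (y : Fin n → EuclideanSpace ℝ (Fin d))
    (μ u : EuclideanSpace ℝ (Fin d)) :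
    quadForm (sampleCov y) u =
      1 / (n : ℝ) * ∑ i, inner ℝ (y i - μ) u ^ 2 - inner ℝ (sampleMean y - μ) u ^ 2 := by
  rw [← average_sq_sub hn (fun i => inner ℝ (y i - μ) u) (m := inner ℝ (sampleMean y - μ) u)]
  · rw [quadForm_eq, sampleCov, Matrix.smul_mulVec, dotProduct_smul, Matrix.sum_mulVec,
      dotProduct_sum, smul_eq_mul]
    congr 1
    refine Finset.sum_congr rfl fun i _ => ?_
    rw [← inner_sub_left, sub_sub_sub_cancel_right, Matrix.vecMulVec_mulVec]
    simp only [EuclideanSpace.inner_eq_star_dotProduct, star_trivial]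
    simp [dotProduct_comm, sq]
  · rw [← sum_inner, sum_sub_eq_smul_sampleMean_sub hn, real_inner_smul_left]

/-- Centring at the true mean produces independent summands; the correction `‖sampleMean y - μ‖²`
later cancels against the distance between means. -/
theorem trace_sampleCov {d n : ℕ} (hn : n ≠ 0) (y : Fin n → EuclideanSpace ℝ (Fin d))
    (μ : EuclideanSpace ℝ (Fin d)) :
    (sampleCov y).trace = 1 / (n : ℝ) * ∑ i, ‖y i - μ‖ ^ 2 - ‖sampleMean y - μ‖ ^ 2 := by
  have h1 : ∀ k, ∑ i, (y i - μ) k = n * (sampleMean y - μ) k := by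
    intro k
    have := congrArg (fun z : EuclideanSpace ℝ (Fin d) => z k)
      (sum_sub_eq_smul_sampleMean_sub hn y μ)
    simpa using this
  have h2 : ∀ k, sampleCov y k k =
      1 / (n : ℝ) * ∑ i, (y i - μ) k ^ 2 - (sampleMean y - μ) k ^ 2 := by
    intro k
    rw [← average_sq_sub hn (fun i => (y i - μ) k) (h1 k), sampleCov, Matrix.smul_apply,
      Matrix.sum_apply, smul_eq_mul]
    congr 1
    refine Finset.sum_congr rfl fun i _ => ?_
    simp [Matrix.vecMulVec_apply, sq]
  simp_rw [Matrix.trace, Matrix.diag_apply, h2, EuclideanSpace.real_norm_sq_eq]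
  rw [Finset.sum_sub_distrib, ← Finset.mul_sum, Finset.sum_comm]

theorem trace_sq_le_spectralNorm_mul_trace {d : ℕ} {S : Matrix (Fin d) (Fin d) ℝ}
    (hS : S.PosSemidef) : (S ^ 2).trace ≤ spectralNorm S * S.trace := by
  obtain ⟨b, l, hl, hlS, -, -, hT, hV⟩ := exists_eigenbasis hS
  rw [hV, hT, Finset.mul_sum]
  refine Finset.sum_le_sum fun k _ => ?_
  rw [sq]
  exact mul_le_mul_of_nonneg_right (hlS k) (hl k)

/-! ### Deterministic consequences of the deviation inequalities -/

/-- The deviation of the squared distance between means, controlled by the mean radius. -/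
theorem two_mul_inner_le_of_inner_le {E : Type*} [NormedAddCommGroup E] [InnerProductSpace ℝ E]
    {g v : E} {D : ℝ} (hD : 0 ≤ D) (h : inner ℝ v g ≤ ‖v‖ * D) :
    2 * inner ℝ v g ≤ 2 * D * (D + ‖g + v‖) := by
  have h0 : 0 ≤ D * D := mul_nonneg hD hD
  have h1 : 0 ≤ D * ‖g + v‖ := mul_nonneg hD (norm_nonneg _)
  by_cases hneg : inner ℝ v g ≤ 0
  · linarith
  -- A positive inner product makes the unknown `‖v‖` smaller than the observed `‖g + v‖`, which is
  -- what the bonus contains.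
  · have h2 : ‖v‖ ≤ ‖g + v‖ := by
      refine le_of_sq_le_sq ?_ (norm_nonneg _)
      rw [norm_add_sq_real, real_inner_comm]
      nlinarith [sq_nonneg ‖g‖]
    nlinarith [mul_le_mul_of_nonneg_right h2 hD]

theorem sqrt_le_meanRadius {d n : ℕ} (S : Matrix (Fin d) (Fin d) ℝ) {δ : ℝ}
    (ht : 0 ≤ Real.log (6 / δ)) :
    (√(n : ℝ))⁻¹ * √(2 * spectralNorm S * Real.log (6 / δ)) ≤ meanRadius S n δ := by
  rw [← Real.sqrt_inv, ← Real.sqrt_mul (by positivity), meanRadius, one_div]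
  refine Real.sqrt_le_sqrt (mul_le_mul_of_nonneg_left ?_ (by positivity))
  have := Real.sqrt_nonneg (8 * (S ^ 2).trace * Real.log (6 / δ))
  nlinarith [mul_nonneg (spectralNorm_nonneg S) ht]

/-- The deviation of the average squared norm. -/
theorem average_norm_sq_le {T V σ t s : ℝ} {n : ℕ} (hn : n ≠ 0) (hT : 0 ≤ T) (hVT : V ≤ T ^ 2)
    (hσ : 0 ≤ σ) (ht : 0 ≤ t) (h : s ≤ n * T + 2 * √(n * V * t) + 2 * σ * t) :
    1 / (n : ℝ) * s - T ≤ T * √(8 / n * t) + 8 * σ / n * t := by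
  have hn' : (0 : ℝ) < n := Nat.cast_pos.2 (Nat.pos_of_ne_zero hn)
  have h1 : √(n * V * t) ≤ n * (T * √(8 / n * t)) / 2 := by
    refine Real.sqrt_le_iff.2 ⟨by positivity, ?_⟩
    have h2 : (n * (T * √(8 / n * t)) / 2) ^ 2 = 2 * (n * T ^ 2 * t) := by
      rw [div_pow, mul_pow, mul_pow, Real.sq_sqrt (by positivity)]
      field_simp
      ring
    rw [h2]
    have h3 : n * V * t ≤ n * T ^ 2 * t := by gcongr
    have h4 : 0 ≤ n * T ^ 2 * t := by positivity
    linarith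
  rw [← mul_le_mul_iff_right₀ hn']
  have h5 : n * (1 / (n : ℝ) * s - T) = s - n * T := by field_simp
  have h6 : n * (T * √(8 / n * t) + 8 * σ / n * t) = n * (T * √(8 / n * t)) + 8 * σ * t := by
    field_simp
  rw [h5, h6]
  nlinarith [mul_nonneg hσ ht]

/-- `T + σ t` is at most a constant times `σ N ρ²`, and `ρ ≤ 1` turns `ρ²` into `ρ`. This makes the
correction for the unknown mean no larger than the covariance error. -/
theorem norm_sq_mean_le {N σ T V t L ρ g : ℝ} (hN : 0 < N) (hσ : 0 < σ) (hT : 0 < T)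
    (hV : V ≤ σ * T) (ht : 0 < t) (htL : t ≤ 2 * L) (hρ0 : 0 < ρ) (hρ1 : ρ ≤ 1)
    (hρ : 4 * (T / σ) + L = N * ρ ^ 2) (h : N * g ≤ T + 2 * √(V * t) + 2 * σ * t) :
    g ≤ 6 * (σ * ρ) := by
  have h1 : √(V * t) ≤ (T + σ * t) / 2 := by
    refine Real.sqrt_le_iff.2 ⟨by positivity, ?_⟩
    nlinarith [sq_nonneg (T - σ * t), mul_le_mul_of_nonneg_right hV ht.le]
  have h2 : 2 * T + 3 * σ * t ≤ 6 * σ * (4 * (T / σ) + L) := by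
    have h3 := mul_le_mul_of_nonneg_left htL hσ.le
    have h4 : 6 * σ * (4 * (T / σ) + L) = 24 * T + 6 * (σ * L) := by
      field_simp
      ring
    rw [h4]
    linarith
  rw [hρ] at h2
  have h3 : N * ρ ^ 2 ≤ N * ρ := by
    refine mul_le_mul_of_nonneg_left ?_ hN.le
    nlinarith
  have h4 := mul_le_mul_of_nonneg_left h3 hσ.le
  refine le_of_mul_le_mul_left ?_ hN
  linarith

theorem sum_norm_sq_sub_le {N σ T V t ρ s : ℝ} (hN : 0 < N) (hT : 0 < T)
    (hσT : σ ≤ T) (hV : V ≤ T ^ 2) (ht : 0 < t) (htN : t ≤ 2 * (N * ρ ^ 2)) (hρ0 : 0 < ρ)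
    (hρ1 : ρ ≤ 1) (h : s ≤ N * T + 2 * √(N * V * t) + 2 * σ * t) :
    s - N * T ≤ 7 * N * T * ρ := by
  -- The constant 7 is `2 · (3/2)` from this term, with `√2 ≤ 3/2`, plus 4 from `2σt`.
  have h1 : √(N * V * t) ≤ N * T * ρ * (3 / 2) := by
    refine Real.sqrt_le_iff.2 ⟨by positivity, ?_⟩
    have h2 : N * V * t ≤ N * T ^ 2 * (2 * (N * ρ ^ 2)) :=
      mul_le_mul (mul_le_mul_of_nonneg_left hV hN.le) htN ht.le (by positivity)
    refine h2.trans ?_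
    have h3 : 0 ≤ (N * T * ρ) ^ 2 := sq_nonneg _
    have h4 : N * T ^ 2 * (2 * (N * ρ ^ 2)) = 2 * (N * T * ρ) ^ 2 := by ring
    rw [h4, mul_pow]
    linarith
  have h2 : σ * t ≤ T * (2 * (N * ρ)) := by
    refine mul_le_mul hσT (htN.trans ?_) ht.le hT.le
    have : ρ ^ 2 ≤ ρ := by nlinarith
    nlinarith
  linarith

theorem le_of_variational_bound {N σ T t ρ Q A B G : ℝ} (hN : 0 < N) (hσ : 0 < σ) (hT : 0 < T)
    (hρ0 : 0 < ρ) (ht : T / σ + t ≤ 2 * (N * ρ ^ 2)) (hB : B - N * T ≤ 7 * N * T * ρ)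
    (hG : G ≤ 6 * (σ * ρ) * (2 * (T / σ)))
    (h : N * (ρ / (7 * T) * (Q + T)
        - (ρ / (7 * T)) ^ 2 * (8 * (σ * (2 * (T / σ))) ^ 2 + 72 * T ^ 2))
      - ρ / (7 * T) * (A + B) - 2 * (T / σ) / 2 ≤ t) :
    Q ≤ 1 / N * A - G + 40 * σ * ρ * (2 * (T / σ)) := by
  -- Here `104 = 8 · 4 + 72`. In units of `N ρ²` the errors are 1 from the norms, `104/49` from the
  -- second moment and 2 from entropy and confidence, in all below `40/7`. Hence `Q - A / N ≤ 40 T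
  -- ρ`; the mean correction adds 12, and 80 is allowed.
  have h1 : N * ρ / (7 * T) * (Q - 1 / N * A) ≤
      ρ / (7 * T) * (B - N * T) + N * (ρ / (7 * T)) ^ 2 * (104 * T ^ 2) + T / σ + t := by
    have h2 : (σ * (2 * (T / σ))) ^ 2 = 4 * T ^ 2 := by
      field_simp
      ring
    rw [h2] at h
    have h3 : N * ρ / (7 * T) * (Q - 1 / N * A) =
        N * (ρ / (7 * T)) * Q - ρ / (7 * T) * A := by field_simp
    rw [h3]
    linarith
  have h4 : ρ / (7 * T) * (B - N * T) ≤ N * ρ ^ 2 := by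
    refine (mul_le_mul_of_nonneg_left hB (by positivity)).trans (le_of_eq ?_)
    field_simp
  have h5 : N * (ρ / (7 * T)) ^ 2 * (104 * T ^ 2) = 104 / 49 * (N * ρ ^ 2) := by
    field_simp
    ring
  have h7 : N * ρ / (7 * T) * (Q - 1 / N * A) ≤ N * ρ / (7 * T) * (40 * (T * ρ)) := by
    have h8 : N * ρ / (7 * T) * (40 * (T * ρ)) = 40 / 7 * (N * ρ ^ 2) := by
      field_simp
    rw [h8]
    have h9 : 0 < N * ρ ^ 2 := by positivity
    linarith
  have h10 := le_of_mul_le_mul_left h7 (by positivity)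
  have h11 : 6 * (σ * ρ) * (2 * (T / σ)) = 12 * (T * ρ) := by
    field_simp
    ring
  have h12 : 40 * σ * ρ * (2 * (T / σ)) = 80 * (T * ρ) := by
    field_simp
    ring
  rw [h11] at hG
  rw [h12]
  have h13 : 0 < T * ρ := by positivity
  linarith

/-- The lower deviation of the empirical covariance matrix, as a consequence of the deviation
inequalities for norms and of the variational bound. -/
theorem quadForm_le_quadForm_sampleCov_add {d n : ℕ} (hn : n ≠ 0)
    {S : Matrix (Fin d) (Fin d) ℝ} (hS : S.PosSemidef) (h0 : S ≠ 0)
    (y : Fin n → EuclideanSpace ℝ (Fin d)) (μ : EuclideanSpace ℝ (Fin d)) {t L ρ : ℝ}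
    (ht : 0 < t) (htL : t ≤ 2 * L) (hρ0 : 0 < ρ) (hρ1 : ρ ≤ 1)
    (hρ : 4 * effectiveRank S + L = n * ρ ^ 2)
    (hsum : ∑ i, ‖y i - μ‖ ^ 2 ≤
      n * S.trace + 2 * √(n * (S ^ 2).trace * t) + 2 * spectralNorm S * t)
    (hmean : n * ‖sampleMean y - μ‖ ^ 2 ≤
      S.trace + 2 * √((S ^ 2).trace * t) + 2 * spectralNorm S * t)
    (hvar : ∀ a, n * (ρ / (7 * S.trace) * (quadForm S a + S.trace)
        - (ρ / (7 * S.trace)) ^ 2 * (8 * (spectralNorm S * ‖a‖ ^ 2) ^ 2 + 72 * S.trace ^ 2))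
      - ρ / (7 * S.trace) * (∑ i, inner ℝ (y i - μ) a ^ 2 + ∑ i, ‖y i - μ‖ ^ 2)
        - ‖a‖ ^ 2 / 2 ≤ t)
    (u : EuclideanSpace ℝ (Fin d)) :
    quadForm S u ≤ quadForm (sampleCov y) u + 40 * spectralNorm S * ρ * ‖u‖ ^ 2 := by
  by_cases hu : u = 0
  · simp [hu, quadForm]
  have hu0 : 0 < ‖u‖ := norm_pos_iff.2 hu
  have hn' : (0 : ℝ) < n := Nat.cast_pos.2 (Nat.pos_of_ne_zero hn)
  have hσ := spectralNorm_pos h0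
  have hσT := spectralNorm_le_trace hS
  have hT : 0 < S.trace := hσ.trans_le hσT
  have hρ' : 4 * (S.trace / spectralNorm S) + L = n * ρ ^ 2 := hρ
  have hr : 0 < S.trace / spectralNorm S := div_pos hT hσ
  have hg := norm_sq_mean_le hn' hσ hT (trace_sq_le_spectralNorm_mul_trace hS) ht htL hρ0 hρ1 hρ'
    hmean
  have hs := sum_norm_sq_sub_le hn' hT hσT (trace_sq_le hS) ht (by linarith) hρ0 hρ1 hsum
  -- The direction is rescaled to squared length twice the effective rank, so that `‖S‖ ‖a‖² = 2 Tr
  -- S` is comparable with the smoothing noise; homogeneity undoes the scaling.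
  obtain ⟨c, hc0, hcu⟩ : ∃ c : ℝ, 0 < c ∧
      ‖c • u‖ ^ 2 = 2 * (S.trace / spectralNorm S) := by
    refine ⟨√(2 * (S.trace / spectralNorm S)) / ‖u‖, by positivity, ?_⟩
    rw [norm_smul, Real.norm_of_nonneg (by positivity), div_mul_cancel₀ _ hu0.ne',
      Real.sq_sqrt (by positivity)]
  have hin : inner ℝ (sampleMean y - μ) (c • u) ^ 2 ≤
      6 * (spectralNorm S * ρ) * (2 * (S.trace / spectralNorm S)) := by
    have h1 : inner ℝ (sampleMean y - μ) (c • u) ^ 2 ≤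
        ‖sampleMean y - μ‖ ^ 2 * ‖c • u‖ ^ 2 := by
      rw [← mul_pow, sq_le_sq, abs_mul, abs_norm, abs_norm]
      exact abs_real_inner_le_norm _ _
    rw [hcu] at h1
    exact h1.trans (mul_le_mul_of_nonneg_right hg (by positivity))
  have hva := hvar (c • u)
  rw [hcu] at hva
  have h := le_of_variational_bound hn' hσ hT hρ0 (by linarith) hs hin hva
  rw [← quadForm_sampleCov hn y μ, quadForm_smul, quadForm_smul, ← hcu, norm_smul, mul_pow,
    Real.norm_of_nonneg hc0.le] at h
  refine le_of_mul_le_mul_left ?_ (pow_pos hc0 2)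
  linarith

/-! ### Optimism from one-sided bounds -/

theorem meanRadius_nonneg {d : ℕ} (S : Matrix (Fin d) (Fin d) ℝ) (n : ℕ) (δ : ℝ) :
    0 ≤ meanRadius S n δ := Real.sqrt_nonneg _

theorem trace_sqrt_nonneg {d : ℕ} (S : Matrix (Fin d) (Fin d) ℝ) : 0 ≤ (CFC.sqrt S).trace :=
  (Matrix.nonneg_iff_posSemidef.1 (CFC.sqrt_nonneg S)).trace_nonneg

theorem bonus_nonneg {d n : ℕ} (y : Fin n → EuclideanSpace ℝ (Fin d))
    (μr : EuclideanSpace ℝ (Fin d)) (Sr : Matrix (Fin d) (Fin d) ℝ)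
    {Sg : Matrix (Fin d) (Fin d) ℝ} (hSg : Sg.PosSemidef) (κ : ℝ) {δ : ℝ}
    (hδ : 0 ≤ Real.log (6 / δ)) : 0 ≤ bonus y μr Sr Sg κ δ := by
  have h1 := meanRadius_nonneg Sg n δ
  have h2 := trace_sqrt_nonneg Sr
  have h3 := spectralNorm_nonneg Sg
  have h4 := hSg.trace_nonneg
  unfold bonus
  positivity

/-- The empirical Fréchet distance is optimistic as soon as the mean, the trace and the covariance
matrix of the sample satisfy one-sided bounds. -/
theorem empiricalFrechetDist_sub_bonus_le {d n : ℕ} (hn : n ≠ 0)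
    (y : Fin n → EuclideanSpace ℝ (Fin d)) (μg μr : EuclideanSpace ℝ (Fin d))
    {Sg Sr : Matrix (Fin d) (Fin d) ℝ} (hSg : Sg.PosSemidef) (hSr : Sr.PosDef) {κ δ : ℝ}
    (hδ : 0 ≤ Real.log (6 / δ)) (hcov0 : 0 < covRadius Sg κ n δ)
    (hmean : inner ℝ (μg - μr) (sampleMean y - μg) ≤ ‖μg - μr‖ * meanRadius Sg n δ)
    (hsum : ∑ i, ‖y i - μg‖ ^ 2 ≤ n * Sg.trace + 2 * √(n * (Sg ^ 2).trace * Real.log (6 / δ))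
      + 2 * spectralNorm Sg * Real.log (6 / δ))
    (hcov : ∀ u, quadForm Sg u ≤
      quadForm (sampleCov y) u + 2 * covRadius Sg κ n δ * ‖u‖ ^ 2) :
    empiricalFrechetDist y μr Sr - bonus y μr Sr Sg κ δ ≤ frechetDist μg Sg μr Sr := by
  have h1 := two_mul_inner_le_of_inner_le (meanRadius_nonneg Sg n δ) hmean
  have h2 := average_norm_sq_le hn hSg.trace_nonneg (trace_sq_le hSg) (spectralNorm_nonneg Sg) hδ
    hsum
  have h3 := trace_principalSqrt_mul_le hSg (posSemidef_sampleCov y) hSr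
    (mul_pos two_pos hcov0) hcov
  have h4 : √(8 * covRadius Sg κ n δ) = 2 * √(2 * covRadius Sg κ n δ) := by
    rw [show 8 * covRadius Sg κ n δ = 2 ^ 2 * (2 * covRadius Sg κ n δ) by ring,
      Real.sqrt_mul (by positivity), Real.sqrt_sq (by norm_num)]
  have h5 : ‖sampleMean y - μr‖ ^ 2 = ‖sampleMean y - μg‖ ^ 2 +
      2 * inner ℝ (μg - μr) (sampleMean y - μg) + ‖μg - μr‖ ^ 2 := by
    rw [← sub_add_sub_cancel (sampleMean y) μg μr, norm_add_sq_real, real_inner_comm]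
  rw [sub_add_sub_cancel] at h1
  unfold empiricalFrechetDist frechetDist bonus
  rw [h5, h4]
  simp only [Matrix.trace_sub, Matrix.trace_add, Matrix.trace_smul, smul_eq_mul]
  rw [trace_sampleCov hn y μg]
  linarith

/-! ### The exceptional event and the degenerate covariance -/

theorem hasLaw_sub_multivariateGaussian {d : ℕ} {α : Type*} [MeasurableSpace α] {p : Measure α}
    {f : α → EuclideanSpace ℝ (Fin d)} {μ : EuclideanSpace ℝ (Fin d)}
    {S : Matrix (Fin d) (Fin d) ℝ} (hf : HasLaw f (multivariateGaussian μ S) p) :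
    HasLaw (fun a => f a - μ) (multivariateGaussian 0 S) p := by
  have h : HasLaw (fun w => w - μ) (multivariateGaussian 0 S) (multivariateGaussian μ S) := by
    refine ⟨by fun_prop, ?_⟩
    unfold multivariateGaussian
    rw [Measure.map_map (by fun_prop) (by fun_prop)]
    congr 1
    ext1 x
    simp
  exact h.comp hf

/-- The deviation inequalities for independent centered Gaussian vectors, off one small event. -/
theorem measureReal_not_deviations_le {d n : ℕ} (hn : n ≠ 0) {S : Matrix (Fin d) (Fin d) ℝ}
    (hS : S.PosSemidef) (h0 : S ≠ 0) (v : EuclideanSpace ℝ (Fin d)) {t l : ℝ} (ht : 0 < t)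
    (hl : 0 ≤ l) :
    (Measure.pi fun _ : Fin n => multivariateGaussian 0 S).real
      {w | ¬ (inner ℝ v ((√(n : ℝ))⁻¹ • ∑ i, w i) ≤ ‖v‖ * √(2 * spectralNorm S * t) ∧
        ∑ i, ‖w i‖ ^ 2 ≤ n * S.trace + 2 * √(n * (S ^ 2).trace * t) + 2 * spectralNorm S * t ∧
        ‖(√(n : ℝ))⁻¹ • ∑ i, w i‖ ^ 2 ≤
          S.trace + 2 * √((S ^ 2).trace * t) + 2 * spectralNorm S * t ∧
        ∀ a, n * (l * (quadForm S a + S.trace)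
          - l ^ 2 * (8 * (spectralNorm S * ‖a‖ ^ 2) ^ 2 + 72 * S.trace ^ 2))
          - l * (∑ i, inner ℝ (w i) a ^ 2 + ∑ i, ‖w i‖ ^ 2) - ‖a‖ ^ 2 / 2 ≤ t)} ≤
      4 * Real.exp (-t) := by
  have h1 := measureReal_inner_gt_le hS h0 v ht
  have h2 := measureReal_sum_norm_sq_gt_le hn hS h0 ht
  have h3 := measureReal_norm_sq_gt_le hS h0 ht
  have h4 := measureReal_not_lowerTail_le (n := n) hS hl t
  -- The normalized sum has the law of a single vector, so two of the one-vector tails apply to the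
  -- sample mean.
  rw [← map_normalized_sum_pi_multivariateGaussian hn hS,
    map_measureReal_apply (by fun_prop) (measurableSet_lt (by fun_prop) (by fun_prop))] at h1 h3
  rw [show 4 * Real.exp (-t) = Real.exp (-t) + Real.exp (-t) + Real.exp (-t) + Real.exp (-t)
    by ring]
  refine le_trans ?_ (add_le_add (add_le_add (add_le_add h1 h2) h3) h4)
  refine le_trans (measureReal_mono ?_) ((measureReal_union_le _ _).trans (add_le_add_left
    ((measureReal_union_le _ _).trans (add_le_add_left (measureReal_union_le _ _) _)) _))
  intro w hw
  by_contra hc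
  simp only [Set.mem_union, Set.mem_preimage, Set.mem_ofPred_eq, not_or, not_lt, not_not] at hc
  exact hw ⟨hc.1.1.1, hc.1.1.2, hc.1.2, hc.2⟩

theorem ae_eq_of_hasLaw_zero {d : ℕ} {α : Type*} [MeasurableSpace α] {p : Measure α}
    {f : α → EuclideanSpace ℝ (Fin d)} {μ : EuclideanSpace ℝ (Fin d)}
    (hf : HasLaw f (multivariateGaussian μ 0) p) : ∀ᵐ a ∂p, f a = μ := by
  have h : multivariateGaussian μ (0 : Matrix (Fin d) (Fin d) ℝ) = Measure.dirac μ := by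
    simp [multivariateGaussian]
  rw [h] at hf
  exact hf.ae_eq_of_dirac

theorem sampleMean_const {d n : ℕ} (hn : n ≠ 0) (μ : EuclideanSpace ℝ (Fin d)) :
    sampleMean (fun _ : Fin n => μ) = μ := by
  have hn' : (n : ℝ) ≠ 0 := Nat.cast_ne_zero.2 hn
  rw [sampleMean, Finset.sum_const, Finset.card_fin, ← Nat.cast_smul_eq_nsmul ℝ, smul_smul,
    one_div_mul_cancel hn', one_smul]

theorem sampleCov_const {d n : ℕ} (hn : n ≠ 0) (μ : EuclideanSpace ℝ (Fin d)) :
    sampleCov (fun _ : Fin n => μ) = 0 := by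
  simp [sampleCov, sampleMean_const hn]

/-- Subadditivity alone suffices, so the good event need not be shown measurable. -/
theorem one_sub_le_measureReal {Ω : Type*} [MeasurableSpace Ω] (P : Measure Ω)
    [IsProbabilityMeasure P] {s : Set Ω} {ε : ℝ} (h : P.real sᶜ ≤ ε) : 1 - ε ≤ P.real s := by
  have h1 := measureReal_union_le (μ := P) s sᶜ
  rw [Set.union_compl_self, probReal_univ] at h1
  linarith

end FrechetOnline

/-! ### The main theorem -/

theorem theorem1 {d : ℕ} {𝒳 Ω : Type*} [MeasurableSpace 𝒳] [MeasurableSpace Ω]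
    -- the generator, the feature map, and the Gaussian law of the generated features
    (p : Measure 𝒳) [IsProbabilityMeasure p] (f : 𝒳 → EuclideanSpace ℝ (Fin d))
    (μg : EuclideanSpace ℝ (Fin d)) (Sg : Matrix (Fin d) (Fin d) ℝ) (hSg : Sg.PosSemidef)
    (hf : HasLaw f (multivariateGaussian μg Sg) p)
    -- the constant `κ` of the centered features
    (κ : ℝ) (hκ : FrechetOnline.SubGaussianConst p (fun x => f x - μg) Sg κ)
    -- mean and covariance matrix of the real data
    (μr : EuclideanSpace ℝ (Fin d)) (Sr : Matrix (Fin d) (Fin d) ℝ) (hSr : Sr.PosDef)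
    -- failure probability and sample size
    (δ : ℝ) (hδ0 : 0 < δ) (hδ1 : δ < 1) (n : ℕ)
    (hn : 4 * FrechetOnline.effectiveRank Sg + Real.log (3 / δ) ≤ (n : ℝ))
    -- `n` independent samples from the generator
    (P : Measure Ω) [IsProbabilityMeasure P] (X : Fin n → Ω → 𝒳)
    (hX : ∀ i, HasLaw (X i) p P) (hindep : iIndepFun X P) :
    1 - δ ≤ P.real {ω |
      FrechetOnline.empiricalFrechetDist (fun i => f (X i ω)) μr Sr
          - FrechetOnline.bonus (fun i => f (X i ω)) μr Sr Sg κ δ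
        ≤ FrechetOnline.frechetDist μg Sg μr Sr} := by
  open FrechetOnline in
  have h3 : 2 ≤ 3 / δ := by
    rw [le_div_iff₀ hδ0]
    linarith
  have hL : 0 < Real.log (3 / δ) := Real.log_pos (by linarith)
  have h6 : 6 / δ = 2 * (3 / δ) := by ring
  have ht : 0 < Real.log (6 / δ) := Real.log_pos (by linarith)
  have htL : Real.log (6 / δ) ≤ 2 * Real.log (3 / δ) := by
    rw [h6, Real.log_mul (by norm_num) (by positivity), two_mul]
    exact add_le_add_left (Real.log_le_log (by norm_num) h3) _
  have hr0 : 0 ≤ effectiveRank Sg := div_nonneg hSg.trace_nonneg (spectralNorm_nonneg Sg)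
  have hn' : (0 : ℝ) < n := by linarith
  have hn0 : n ≠ 0 := by
    rintro rfl
    simp at hn'
  have hfX : ∀ i, HasLaw (fun ω => f (X i ω)) (multivariateGaussian μg Sg) P :=
    fun i => hf.comp (hX i)
  by_cases h0 : Sg = 0
  -- The tail bounds need `Sg ≠ 0`. Here the features are almost surely constant, so the two
  -- distances agree and a nonnegative bonus is enough.
  · subst h0
    have hae : ∀ᵐ ω ∂P, ∀ i, f (X i ω) = μg := ae_all_iff.2 fun i => ae_eq_of_hasLaw_zero (hfX i)
    refine one_sub_le_measureReal P ?_
    refine le_trans (le_of_eq ?_) hδ0.le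
    rw [measureReal_eq_zero_iff]
    refine measure_mono_null (t := {ω | ¬ ∀ i, f (X i ω) = μg}) (fun ω hω h => hω ?_)
      (ae_iff.1 hae)
    have hy : (fun i => f (X i ω)) = fun _ => μg := funext h
    have hb := bonus_nonneg (fun _ : Fin n => μg) μr Sr hSg κ ht.le
    rw [Set.mem_ofPred_eq, hy, empiricalFrechetDist, sampleMean_const hn0, sampleCov_const hn0]
    linarith
  set ρ := √((4 * effectiveRank Sg + Real.log (3 / δ)) / n) with hρ
  have hpos : 0 < 4 * effectiveRank Sg + Real.log (3 / δ) := by linarith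
  have hρ0 : 0 < ρ := Real.sqrt_pos.2 (div_pos hpos hn')
  have hρ1 : ρ ≤ 1 := Real.sqrt_le_one.2 ((div_le_one hn').2 hn)
  have hρn : 4 * effectiveRank Sg + Real.log (3 / δ) = n * ρ ^ 2 := by
    rw [hρ, Real.sq_sqrt (div_pos hpos hn').le]
    field_simp
  have hσ := spectralNorm_pos h0
  have hκ1 : 1 ≤ κ := one_le_of_subGaussianConst hSg h0 hf hκ
  have hcov : 20 * spectralNorm Sg * ρ ≤ covRadius Sg κ n δ := by
    rw [covRadius, ← hρ]
    have h1 : 1 ≤ κ ^ 2 := one_le_pow₀ hκ1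
    nlinarith [mul_le_mul_of_nonneg_right h1 (mul_pos hσ hρ0).le,
      sq_nonneg (meanRadius Sg n δ)]
  have hlaw : HasLaw (fun ω i => f (X i ω) - μg)
      (Measure.pi fun _ : Fin n => multivariateGaussian 0 Sg) P := by
    refine iIndepFun.hasLaw_pi (fun i => hasLaw_sub_multivariateGaussian (hfX i)) ?_
    refine hindep.comp₀ (fun _ x => f x - μg) (fun i => (hX i).aemeasurable) fun i => ?_
    rw [(hX i).map_eq]
    exact (hasLaw_sub_multivariateGaussian hf).aemeasurable
  -- The rate `l` of order `ρ / Tr Sg` balances the linear gain against the quadratic loss in the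
  -- variational bound.
  have hbad := measureReal_not_deviations_le hn0 hSg h0 (μg - μr) ht
    (l := ρ / (7 * Sg.trace)) (div_nonneg hρ0.le (mul_nonneg (by norm_num) hSg.trace_nonneg))
  have hexp : 4 * Real.exp (-Real.log (6 / δ)) ≤ δ := by
    rw [Real.exp_neg, Real.exp_log (by positivity), inv_div]
    linarith
  rw [← hlaw.map_eq] at hbad
  refine one_sub_le_measureReal P (le_trans ?_ (hbad.trans hexp))
  -- The exceptional set quantifies over all `a`, so the transfer to `Ω` uses the inequality for the
  -- measure of a preimage, valid for arbitrary sets.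
  refine le_trans (measureReal_mono fun ω hω => ?_)
    (ENNReal.toReal_mono (measure_ne_top _ _) (Measure.le_map_apply hlaw.aemeasurable _))
  rw [Set.mem_preimage, Set.mem_ofPred_eq]
  rintro ⟨e1, e2, e3, e4⟩
  apply hω
  rw [Set.mem_ofPred_eq]
  have hsum : (√(n : ℝ))⁻¹ • ∑ i, (f (X i ω) - μg) =
      √(n : ℝ) • (sampleMean (fun i => f (X i ω)) - μg) := by
    rw [sum_sub_eq_smul_sampleMean_sub hn0 (fun i => f (X i ω)), smul_smul]
    congr 1
    rw [inv_mul_eq_iff_eq_mul₀ (Real.sqrt_pos.2 hn').ne', Real.mul_self_sqrt hn'.le]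
  rw [hsum] at e1 e3
  rw [norm_smul, mul_pow, Real.norm_of_nonneg (Real.sqrt_nonneg _), Real.sq_sqrt hn'.le] at e3
  rw [real_inner_smul_right] at e1
  have hs := Real.sqrt_pos.2 hn'
  refine empiricalFrechetDist_sub_bonus_le hn0 _ μg μr hSg hSr ht.le
    (lt_of_lt_of_le (by positivity) hcov) ?_ e2 fun u => ?_
  · refine le_trans ?_ (mul_le_mul_of_nonneg_left (sqrt_le_meanRadius Sg ht.le) (norm_nonneg _))
    rw [mul_left_comm, inv_mul_eq_div, le_div_iff₀' hs]
    exact e1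
  · refine (quadForm_le_quadForm_sampleCov_add hn0 hSg h0 _ μg ht htL hρ0 hρ1 hρn e2 e3 e4 u).trans
      ?_
    refine add_le_add_right (mul_le_mul_of_nonneg_right ?_ (sq_nonneg _)) _
    linarith
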